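/- Write points of $\mathbb R^{n+1}$ ($n\ge 1$) as $(X,t)$ with $X\in\mathbb R^n$, $t\in\mathbb R$. Let $d_p((X,t),(Y,s))=|X-Y|+|t-s|^{1/2}$, let $\operatorname{diam}$ be the $d_p$-diameter, and for $r>0$ let $Q_r(X,t)=\{(Y,s):|y_i-x_i|<r \text{ for } 1\le i\le n,\ |s-t|<r^2\}$; sets of this form are called parabolic cubes. Let $\mathcal H_p^{n+1}$ be the parabolic Hausdorff measure of homogeneous dimension $n+1$, $$\mathcal H_p^{n+1}(E)=\lim_{\delta\to0^+}\ \inf\Big\{\sum_k \operatorname{diam}(A_k)^{n+1}\Big\},$$ the infimum being over countable coverings $(A_k)$ of $E$ by parabolic cubes with $\operatorname{diam}(A_k)\le\delta$. For a closed set $\Sigma\subset\mathbb R^{n+1}$ let $\sigma=\mathcal H_p^{n+1}|_\Sigma$, $T_0=\inf\{t:(X,t)\in\Sigma\}$, $T_1=\sup\{t:(X,t)\in\Sigma\}$, $\Delta(X,t,r)=\Sigma\cap Q_r(X,t)$, $\Delta^{+}(X,t,r)=\Delta(X,t,r)\cap\{(Y,s):s\ge t\}$ and $\Delta^{-}(X,t,r)=\Delta(X,t,r)\cap\{(Y,s):s\le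 t\}$. * $\Sigma$ is *parabolic ADR with constant $M\ge1$* if $M^{-1}r^{n+1}\le\sigma(\Delta(X,t,r))\le M r^{n+1}$ whenever $(X,t)\in\Sigma$, $T_0<t<T_1$ and $0<r<\operatorname{diam}\Sigma$. * A parabolic ADR set $\Sigma$ is *time-symmetric ADR with constant $M'\ge1$* if $T_0=-\infty$, $T_1=\infty$, and $\sigma(\Delta^{+}(X,t,r))\ge (M')^{-1}r^{n+1}$ and $\sigma(\Delta^{-}(X,t,r))\ge (M')^{-1}r^{n+1}$ for all $(X,t)\in\Sigma$ and $0<r<\operatorname{diam}\Sigma$. * An open set $\Omega$ with $\partial\Omega=\Sigma$ satisfies the *two-sided corkscrew condition relative to $\Omega$ with constant $\gamma_0\in(0,1)$* if for all $(X,t)\in\Sigma$ with $T_0<t<T_1$ and all $0<r<\operatorname{diam}\Sigma$ there are $\rho$ with $\gamma_0r\le\rho<r$ and two cubes $Q_\rho(X_1,t_1),Q_\rho(X_2,t_2)\subset Q_r(X,t)$ with $Q_\rho(X_1,t_1)\cap(\mathbb R^n\times(T_0,T_1))\subset\Omega$ and $Q_\rho(X_2,t_2)\cap(\mathbb R^n\times(T_0,T_1))\subset\mathbb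 R^{n+1}\setminus\overline\Omega$. * A function $\psi:\mathbb R^{n-1}\times\mathbb R\to\mathbb R$ is *Lip(1,1/2) with constant $b$* if $|\psi(x,t)-\psi(y,s)|\le b(|x-y|+|t-s|^{1/2})$ for all $(x,t),(y,s)$. * For $(z,\tau)\in\mathbb R^{n-1}\times\mathbb R$ let $I_r(z,\tau)=\{(y,s)\in\mathbb R^{n-1}\times\mathbb R:|y_i-z_i|<r \text{ for } 1\le i\le n-1,\ |s-\tau|<r^2\}$, and let $\pi(x,x_n,t)=(x,t)$ for $(x,x_n,t)\in\mathbb R^{n-1}\times\mathbb R\times\mathbb R$. * For an open set $\Omega$ with $\partial\Omega=\Sigma$, the set $\partial\Omega$ satisfies a *uniform interior big pieces of Lip(1,1/2) graphs condition with constants $(\epsilon,b,C,c,A)$*, where $\epsilon>0$, $b\ge0$, $C\ge1$, $c>0$, $A>0$, if for every $(\hat X,\hat t)\in\Omega$, with $d:=d_p((\hat X,\hat t),\Sigma)$, there are a Lip(1,1/2) function $\psi$ with constant $b$, a domain (connected open set) $\tilde\Omega$ and a point $(X,t)\in\Sigma\cap Q_{Cd}(\hat X,\hat t)$ with $\Delta(X,t,d/2)\subset\Sigma\cap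 Q_{Cd}(\hat X,\hat t)$ such that (i) $Q_{\epsilon d}(\hat X,\hat t)\subset\tilde\Omega\subset\Omega\cap Q_{Cd}(\hat X,\hat t)$; and, after an orthogonal change of the space variables, in which $(\hat X,\hat t)=(\hat x,\hat x_n,\hat t)$ and $(X,t)=(x,x_n,t)$, (ii) $\tilde\Omega=\{(y,y_n,s):(y,s)\in I_{cd}(x,t),\ \psi(y,s)<y_n<\hat x_n+Ad\}$; (iii) $\mathcal H^n\big(\pi(\Sigma\cap\partial\tilde\Omega)\cap I_{cd}(x,t)\big)\ge\epsilon d^{n+1}$, where $\mathcal H^n$ is $n$-dimensional Lebesgue measure on $\mathbb R^{n-1}\times\mathbb R$. **Statement.** Let $n\ge1$, $M\ge1$, $M'\ge1$ and $\gamma_0\in(0,1)$. There are constants $\epsilon>0$, $b\ge0$, $C\ge1$, $c>0$, $A>0$, depending only on $n,M,\gamma_0$ and $M'$, such that the following holds. Let $\Omega\subset\mathbb R^{n+1}$ be an open set whose boundary $\Sigma=\partial\Omega$ is parabolic ADR with constant $M$ and time-symmetric ADR with constant $M'$, and suppose that $\Omega$ satisfies the two-sided corkscrew condition relative to $\Omega$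 with constant $\gamma_0$. Then $\partial\Omega$ satisfies the uniform interior big pieces of Lip(1,1/2) graphs condition with constants $(\epsilon,b,C,c,A)$. -/

import Mathlib

open scoped ENNReal

/-- Space-time `ℝⁿ × ℝ`: points `(X, t)`, with the Euclidean norm on the space variable. -/
abbrev SpaceTime (n : ℕ) : Type := EuclideanSpace ℝ (Fin n) × ℝ

namespace Parabolic

/-- The parabolic distance `d_p(X,t,Y,s) = |X - Y| + |t - s|^{1/2}`. -/
noncomputable def pdist {n : ℕ} (P Q : SpaceTime n) : ℝ :=
  ‖P.1 - Q.1‖ + Real.sqrt |P.2 - Q.2|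

/-- The parabolic distance from a point to a (non-empty) set. -/
noncomputable def pdistSet {n : ℕ} (P : SpaceTime n) (E : Set (SpaceTime n)) : ℝ :=
  ⨅ Q : E, pdist P (Q : SpaceTime n)

/-- The parabolic diameter, possibly infinite. -/
noncomputable def pdiam {n : ℕ} (E : Set (SpaceTime n)) : ℝ≥0∞ :=
  ⨆ P ∈ E, ⨆ Q ∈ E, ENNReal.ofReal (pdist P Q)

/-- The parabolic cube `Q_r(X,t) = {(Y,s) : |y_i - x_i| < r for all i, |t - s| < r²}`. -/
def cube {n : ℕ} (P : SpaceTime n) (r : ℝ) : Set (SpaceTime n) :=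
  {Q | (∀ i, |Q.1 i - P.1 i| < r) ∧ |Q.2 - P.2| < r ^ 2}

/-- `E` is a parabolic cube (of positive length). -/
def IsCube {n : ℕ} (E : Set (SpaceTime n)) : Prop :=
  ∃ (P : SpaceTime n) (r : ℝ), 0 < r ∧ E = cube P r

/-- The size-`δ` approximation of parabolic Hausdorff measure: the infimum of
`∑ₖ diam_p(Aₖ) ^ η` over countable coverings by parabolic cubes `Aₖ` with `diam_p(Aₖ) ≤ δ`
(all other non-empty sets get the value `∞`, hence do not contribute to the infimum). -/
noncomputable def hausdorffPre (n : ℕ) (η : ℝ) (δ : ℝ≥0∞) :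
    MeasureTheory.OuterMeasure (SpaceTime n) :=
  MeasureTheory.OuterMeasure.boundedBy fun A =>
    ⨅ (_ : IsCube A) (_ : pdiam A ≤ δ), pdiam A ^ η

/-- Parabolic Hausdorff (outer) measure of homogeneous dimension `η`: the limit as `δ → 0+`, that
is the supremum over `δ > 0`, of the size-`δ` approximations. -/
noncomputable def hausdorff (n : ℕ) (η : ℝ) : MeasureTheory.OuterMeasure (SpaceTime n) :=
  ⨆ (δ : ℝ≥0∞) (_ : 0 < δ), hausdorffPre n η δ

/-- Surface measure `σ(E)` of a subset `E` of a closed set in `ℝⁿ⁺¹`: the parabolic Hausdorff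
measure of homogeneous dimension `n + 1`. -/
noncomputable def surf {n : ℕ} (E : Set (SpaceTime n)) : ℝ≥0∞ :=
  hausdorff n ((n : ℝ) + 1) E

/-- The infimal time coordinate `T₀` of a set (`⊥` means `-∞`). -/
noncomputable def T0 {n : ℕ} (S : Set (SpaceTime n)) : EReal := ⨅ P ∈ S, ((P.2 : ℝ) : EReal)

/-- The supremal time coordinate `T₁` of a set (`⊤` means `∞`). -/
noncomputable def T1 {n : ℕ} (S : Set (SpaceTime n)) : EReal := ⨆ P ∈ S, ((P.2 : ℝ) : EReal)

/-- The slab `ℝⁿ × (T₀, T₁)`. -/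
def slab {n : ℕ} (S : Set (SpaceTime n)) : Set (SpaceTime n) :=
  {P | T0 S < ((P.2 : ℝ) : EReal) ∧ ((P.2 : ℝ) : EReal) < T1 S}

/-- The surface cube `Δ(X,t,r) = S ∩ Q_r(X,t)`. -/
def surfCube {n : ℕ} (S : Set (SpaceTime n)) (P : SpaceTime n) (r : ℝ) : Set (SpaceTime n) :=
  S ∩ cube P r

/-- The closed set `S` is parabolic Ahlfors-David regular with constant `M`. -/
def IsADR {n : ℕ} (S : Set (SpaceTime n)) (M : ℝ) : Prop :=
  IsClosed S ∧ ∀ P ∈ S, P ∈ slab S → ∀ r : ℝ, 0 < r → ENNReal.ofReal r < pdiam S →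
    ENNReal.ofReal (M⁻¹ * r ^ (n + 1)) ≤ surf (surfCube S P r) ∧
      surf (surfCube S P r) ≤ ENNReal.ofReal (M * r ^ (n + 1))

/-- The lower bound on time-forward halves of surface cubes, and `T₁ = ∞`. -/
def IsTimeForwardADR {n : ℕ} (S : Set (SpaceTime n)) (M' : ℝ) : Prop :=
  T1 S = ⊤ ∧ ∀ P ∈ S, T0 S < ((P.2 : ℝ) : EReal) →
    ∀ r : ℝ, 0 < r → ENNReal.ofReal r < pdiam S →
      ENNReal.ofReal (M'⁻¹ * r ^ (n + 1)) ≤ surf (surfCube S P r ∩ {Q | P.2 ≤ Q.2})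

/-- The lower bound on time-backward halves of surface cubes, and `T₀ = -∞`. -/
def IsTimeBackwardADR {n : ℕ} (S : Set (SpaceTime n)) (M' : ℝ) : Prop :=
  T0 S = ⊥ ∧ ∀ P ∈ S, ((P.2 : ℝ) : EReal) < T1 S →
    ∀ r : ℝ, 0 < r → ENNReal.ofReal r < pdiam S →
      ENNReal.ofReal (M'⁻¹ * r ^ (n + 1)) ≤ surf (surfCube S P r ∩ {Q | Q.2 ≤ P.2})

/-- Time-symmetric Ahlfors-David regularity with constant `M'`. -/
def IsTimeSymmetricADR {n : ℕ} (S : Set (SpaceTime n)) (M' : ℝ) : Prop :=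
  IsTimeForwardADR S M' ∧ IsTimeBackwardADR S M'

/-- The two-sided corkscrew condition with respect to the open set `Ω`, with constant `γ₀`: one
corkscrew cube in `Ω` and one in the complement of its closure. -/
def Corkscrew {n : ℕ} (Ω : Set (SpaceTime n)) (γ₀ : ℝ) : Prop :=
  ∀ P ∈ frontier Ω, P ∈ slab (frontier Ω) →
    ∀ r : ℝ, 0 < r → ENNReal.ofReal r < pdiam (frontier Ω) →
      ∃ (ρ : ℝ) (P₁ P₂ : SpaceTime n), γ₀ * r ≤ ρ ∧ ρ < r ∧
        cube P₁ ρ ⊆ cube P r ∧ cube P₂ ρ ⊆ cube P r ∧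
        cube P₁ ρ ∩ slab (frontier Ω) ⊆ Ω ∧
        cube P₂ ρ ∩ slab (frontier Ω) ⊆ (closure Ω)ᶜ

/-- `ψ` is a Lip(1,1/2) function with constant `b`. -/
def IsLipHalf {m : ℕ} (ψ : SpaceTime m → ℝ) (b : ℝ) : Prop :=
  ∀ p q : SpaceTime m, |ψ p - ψ q| ≤ b * pdist p q

/-- The orthogonal projection `π(x, x_n, t) = (x, t)`, where `n = m + 1` and the hyperplane
`{x_n = 0}` is identified with `ℝ^{n-1} × ℝ`. -/
noncomputable def proj {m : ℕ} (P : SpaceTime (m + 1)) : SpaceTime m :=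
  (WithLp.toLp 2 fun i : Fin m => P.1 i.castSucc, P.2)

/-- The last space coordinate `x_n` of `(x, x_n, t)`, where `n = m + 1`. -/
def lastCoord {m : ℕ} (P : SpaceTime (m + 1)) : ℝ := P.1 (Fin.last m)

/-- Orthogonal change of the space variables, leaving time fixed. -/
noncomputable def rot {n : ℕ} (ϱ : EuclideanSpace ℝ (Fin n) ≃ₗᵢ[ℝ] EuclideanSpace ℝ (Fin n))
    (P : SpaceTime n) : SpaceTime n :=
  (ϱ P.1, P.2)

/-- The region `{(y, y_n, s) : (y,s) ∈ I_ℓ(z), ψ(y,s) < y_n < a}`, where `I_ℓ(z)` is the parabolic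
cube in `ℝ^{n-1} × ℝ`, `n = m + 1`. -/
def graphRegion {m : ℕ} (ψ : SpaceTime m → ℝ) (z : SpaceTime m) (ℓ a : ℝ) :
    Set (SpaceTime (m + 1)) :=
  {P | proj P ∈ cube z ℓ ∧ ψ (proj P) < lastCoord P ∧ lastCoord P < a}

/-- Uniform interior big pieces of Lip(1,1/2) graphs for the boundary of the open set `Ω` in
`ℝⁿ × ℝ`, `n = m + 1`, with constants `ε, b, C, c, A`. On `ℝ^{n-1} × ℝ` the measure `ℋⁿ` is
Lebesgue measure. The domain `D` is described in the coordinates given by `ϱ`. -/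
def InteriorBigPieces {m : ℕ} (Ω : Set (SpaceTime (m + 1))) (ε b C c A : ℝ) : Prop :=
  ∀ Phat ∈ Ω, ∃ (ψ : SpaceTime m → ℝ) (D : Set (SpaceTime (m + 1)))
    (ϱ : EuclideanSpace ℝ (Fin (m + 1)) ≃ₗᵢ[ℝ] EuclideanSpace ℝ (Fin (m + 1)))
    (P : SpaceTime (m + 1)),
    let S := frontier Ω
    let d := pdistSet Phat S
    IsLipHalf ψ b ∧ IsOpen D ∧ IsConnected D ∧
    (cube Phat (ε * d) ⊆ D ∧ D ⊆ Ω ∩ cube Phat (C * d)) ∧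
    (P ∈ S ∩ cube Phat (C * d) ∧ surfCube S P (d / 2) ⊆ S ∩ cube Phat (C * d) ∧
      D = rot ϱ ⁻¹' graphRegion ψ (proj (rot ϱ P)) (c * d) (lastCoord (rot ϱ Phat) + A * d)) ∧
    ENNReal.ofReal (ε * d ^ (m + 2)) ≤
      MeasureTheory.volume
        ((fun Q => proj (rot ϱ Q)) '' (S ∩ frontier D) ∩ cube (proj (rot ϱ P)) (c * d))

end Parabolic

open MeasureTheory Set

namespace Parabolic

/-! ### Elementary geometry of parabolic cubes -/

/-! Let `d` be the distance from a point of `Ω` to the boundary `S`. Time symmetry lets one walk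
along `S` to almost the time level of the point, moving a distance comparable to `d`, and the
corkscrew condition supplies an exterior cube there (`exists_exterior_cube`). A rotation puts this
cube below the given point, so every vertical line through the cube's shadow crosses `S`. Take for
`ψ` the least Lip(1,1/2) function with large constant `b` above all points of `S` in the column
between the two points. The region above its graph lies in `Ω`, and it remains to show that the
graph meets `S` over half of the shadow.

If the graph misses `S` over `y`, the highest boundary point over `y`, at height `f`, lies below a
steep cone with vertex at some `w` in `S`. For `b` large there are `N` geometric scales `s` between
the horizontal distance from `y` to `w` and a fixed fraction of their height difference. At each of
them, between `f` and `w`, there is either a stack of `k` separated boundary points near the line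
over `y`, or a cube of size `2 s` on that line inside `Ω` (`exists_window_or_stack`).

Stacks are rare because disjoint surface cubes pack: their base has volume `O(1/k)`
(`volume_stacked_le`). In the other case the exterior corkscrew cube of `w` lies above an interior
cube, and the number of alternations between `Ω` and its exterior grows by one over a set of `y'` of
size comparable to `s` (`exists_shadow`). Each alternation uses up a separate cube of a fine
covering of `S`, so the total volume of these sets over all scales is bounded
(`tsum_volume_le_of_alternates`). A Chebyshev estimate then bounds the base of points seeing `N`
such scales by `O(1/N)` (`volume_shadowed_le`). Large `k` and `N` finish the proof.

Parabolic cubes are not rotation invariant, so surface measure is first replaced by the covering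
properties `CubeCoverable` and `CubeContent`, which survive rotations up to constants. -/

lemma mem_cube {n : ℕ} {P Q : SpaceTime n} {r : ℝ} :
    Q ∈ cube P r ↔ (∀ i, |Q.1 i - P.1 i| < r) ∧ |Q.2 - P.2| < r ^ 2 := Iff.rfl

lemma self_mem_cube {n : ℕ} (P : SpaceTime n) {r : ℝ} (hr : 0 < r) : P ∈ cube P r := by
  simp [mem_cube, hr]

lemma mem_cube_comm {n : ℕ} {P Q : SpaceTime n} {r : ℝ} : Q ∈ cube P r ↔ P ∈ cube Q r := by
  simp only [mem_cube, abs_sub_comm]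

lemma isOpen_cube {n : ℕ} (P : SpaceTime n) (r : ℝ) : IsOpen (cube P r) := by
  have : cube P r = (⋂ i, {Q : SpaceTime n | |Q.1 i - P.1 i| < r}) ∩ {Q | |Q.2 - P.2| < r ^ 2} := by
    ext Q; simp [mem_cube]
  rw [this]
  refine (isOpen_iInter_of_finite fun i => ?_).inter ?_
  · exact isOpen_lt (by fun_prop) continuous_const
  · exact isOpen_lt (by fun_prop) continuous_const

lemma isOpen_setOf_mem_cube {n : ℕ} (r : ℝ) :
    IsOpen {p : SpaceTime n × SpaceTime n | p.2 ∈ cube p.1 r} := by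
  have : {p : SpaceTime n × SpaceTime n | p.2 ∈ cube p.1 r}
      = (⋂ i, {p | |p.2.1 i - p.1.1 i| < r}) ∩ {p | |p.2.2 - p.1.2| < r ^ 2} := by
    ext Q; simp [mem_cube]
  rw [this]
  refine (isOpen_iInter_of_finite fun i => ?_).inter ?_
  · exact isOpen_lt (by fun_prop) continuous_const
  · exact isOpen_lt (by fun_prop) continuous_const

lemma convex_cube {n : ℕ} (P : SpaceTime n) (r : ℝ) : Convex ℝ (cube P r) := by
  have aux : ∀ (a b u v p ρ : ℝ), 0 ≤ a → 0 ≤ b → a + b = 1 → |u - p| < ρ → |v - p| < ρ →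
      |a * u + b * v - p| < ρ := by
    intro a b u v p ρ ha hb hab hu hv
    have h := convex_ball p ρ (x := u) (y := v)
      (by simpa [Real.dist_eq] using hu) (by simpa [Real.dist_eq] using hv) ha hb hab
    simpa [Real.dist_eq] using h
  intro x hx y hy a b ha hb hab
  refine ⟨fun i => ?_, ?_⟩
  · simpa using aux a b _ _ _ _ ha hb hab (hx.1 i) (hy.1 i)
  · simpa using aux a b _ _ _ _ ha hb hab hx.2 hy.2

lemma cube_mono {n : ℕ} (P : SpaceTime n) {r s : ℝ} (hr : 0 ≤ r) (h : r ≤ s) :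
    cube P r ⊆ cube P s := fun Q hQ =>
  ⟨fun i => (hQ.1 i).trans_le h, hQ.2.trans_le (by gcongr)⟩

/-- Two parabolic cubes compose as long as both radii and squared radii add up. -/
lemma mem_cube_trans {n : ℕ} {P Q R : SpaceTime n} {r s u : ℝ} (h₁ : Q ∈ cube P r)
    (h₂ : R ∈ cube Q s) (hu : r + s ≤ u) (hu2 : r ^ 2 + s ^ 2 ≤ u ^ 2) : R ∈ cube P u := by
  refine ⟨fun i => ?_, ?_⟩
  · have := abs_sub_le (R.1 i) (Q.1 i) (P.1 i)
    linarith [h₁.1 i, h₂.1 i]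
  · have := abs_sub_le R.2 Q.2 P.2
    linarith [h₁.2, h₂.2]

lemma mem_cube_add {n : ℕ} {P Q R : SpaceTime n} {r s : ℝ} (h₁ : Q ∈ cube P r)
    (h₂ : R ∈ cube Q s) (hr : 0 ≤ r) (hs : 0 ≤ s) : R ∈ cube P (r + s) :=
  mem_cube_trans h₁ h₂ le_rfl (by nlinarith [mul_nonneg hr hs])

lemma cube_subset_cube {n : ℕ} {P Q : SpaceTime n} {r s u : ℝ} (h₁ : Q ∈ cube P r)
    (hu : r + s ≤ u) (hu2 : r ^ 2 + s ^ 2 ≤ u ^ 2) : cube Q s ⊆ cube P u :=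
  fun _ h => mem_cube_trans h₁ h hu hu2

lemma norm_le_of_forall_abs_le {n : ℕ} (v : EuclideanSpace ℝ (Fin n)) {s : ℝ}
    (h : ∀ i, |v i| ≤ s) : ‖v‖ ≤ n * s := by
  calc ‖v‖ = ‖∑ i, EuclideanSpace.single i (v i)‖ := by
        congr 1; ext j; simp
    _ ≤ ∑ i : Fin n, ‖EuclideanSpace.single i (v i)‖ := norm_sum_le _ _
    _ ≤ ∑ i : Fin n, s := by
        refine Finset.sum_le_sum fun i _ => ?_
        simpa using h i
    _ = n * s := by simp

lemma exists_cube_subset {n : ℕ} {U : Set (SpaceTime n)} (hU : IsOpen U) {P : SpaceTime n}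
    (hP : P ∈ U) : ∃ s : ℝ, 0 < s ∧ cube P s ⊆ U := by
  obtain ⟨ε, hε, hs⟩ := Metric.isOpen_iff.1 hU P hP
  have hn : (0 : ℝ) ≤ n := Nat.cast_nonneg n
  refine ⟨min 1 (ε / (n + 1)), by positivity, fun Q hQ => hs ?_⟩
  set s := min 1 (ε / ((n : ℝ) + 1)) with hsdef
  have h1 : s ≤ 1 := min_le_left _ _
  have h2 : s * (n + 1) ≤ ε := by
    have := min_le_right 1 (ε / ((n : ℝ) + 1))
    rwa [← hsdef, le_div_iff₀ (by positivity)] at this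
  have hs0 : 0 < s := by positivity
  have hnorm : ‖Q.1 - P.1‖ ≤ n * s :=
    norm_le_of_forall_abs_le _ fun i => by simpa using (hQ.1 i).le
  rw [Metric.mem_ball, Prod.dist_eq, max_lt_iff]
  constructor
  · rw [dist_eq_norm]; nlinarith
  · rw [Real.dist_eq]
    have : |Q.2 - P.2| < s ^ 2 := hQ.2
    nlinarith

lemma abs_coord_le_norm {n : ℕ} (v : EuclideanSpace ℝ (Fin n)) (i : Fin n) : |v i| ≤ ‖v‖ := by
  simpa using PiLp.norm_apply_le v i

lemma cube_subset_ball_pdist {n : ℕ} {P Q : SpaceTime n} {r : ℝ} (hr : 0 < r)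
    (h : Q ∈ cube P r) : pdist P Q < (n + 1) * r := by
  have h1 : ‖P.1 - Q.1‖ ≤ n * r := norm_le_of_forall_abs_le _ fun i => by
    simpa [abs_sub_comm] using (h.1 i).le
  have h2 : Real.sqrt |P.2 - Q.2| < r := by
    rw [Real.sqrt_lt' hr, abs_sub_comm]; exact h.2
  unfold pdist; linarith

lemma mem_cube_of_pdist_lt {n : ℕ} {P Q : SpaceTime n} {r : ℝ} (h : pdist P Q < r) :
    Q ∈ cube P r := by
  have h0 := norm_nonneg (P.1 - Q.1)
  have h0' := Real.sqrt_nonneg |P.2 - Q.2|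
  unfold pdist at h
  refine ⟨fun i => ?_, ?_⟩
  · have := abs_coord_le_norm (P.1 - Q.1) i
    rw [abs_sub_comm]
    simp only [PiLp.sub_apply] at this
    linarith
  · rw [abs_sub_comm, ← Real.sqrt_lt' (by linarith)]; linarith

lemma pdist_nonneg {n : ℕ} (P Q : SpaceTime n) : 0 ≤ pdist P Q :=
  add_nonneg (norm_nonneg _) (Real.sqrt_nonneg _)

lemma pdist_comm {n : ℕ} (P Q : SpaceTime n) : pdist P Q = pdist Q P := by
  simp only [pdist, norm_sub_rev, abs_sub_comm]

lemma pdist_triangle {n : ℕ} (P Q R : SpaceTime n) : pdist P R ≤ pdist P Q + pdist Q R := by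
  have h1 := norm_sub_le_norm_sub_add_norm_sub P.1 Q.1 R.1
  have h2 : Real.sqrt |P.2 - R.2| ≤ Real.sqrt |P.2 - Q.2| + Real.sqrt |Q.2 - R.2| :=
    Real.sqrt_le_iff.2 ⟨by positivity, by
      have h3 := Real.sq_sqrt (abs_nonneg (P.2 - Q.2))
      have h4 := Real.sq_sqrt (abs_nonneg (Q.2 - R.2))
      have h5 := mul_nonneg (Real.sqrt_nonneg |P.2 - Q.2|) (Real.sqrt_nonneg |Q.2 - R.2|)
      nlinarith [abs_sub_le P.2 Q.2 R.2]⟩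
  unfold pdist; linarith

lemma eq_of_pdist_eq_zero {n : ℕ} {P Q : SpaceTime n} (h : pdist P Q = 0) : P = Q := by
  have h0 := norm_nonneg (P.1 - Q.1)
  have h0' := Real.sqrt_nonneg |P.2 - Q.2|
  unfold pdist at h
  have h1 : ‖P.1 - Q.1‖ = 0 := by linarith
  have h2 : Real.sqrt |P.2 - Q.2| = 0 := by linarith
  rw [Real.sqrt_eq_zero (abs_nonneg _), abs_eq_zero, sub_eq_zero] at h2
  exact Prod.ext (sub_eq_zero.1 (norm_eq_zero.1 h1)) h2

lemma volume_cube {m : ℕ} (P : SpaceTime m) {r : ℝ} (hr : 0 ≤ r) :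
    volume (cube P r) = ENNReal.ofReal (2 ^ (m + 1) * r ^ (m + 2)) := by
  have : cube P r = ((@WithLp.ofLp 2 (Fin m → ℝ)) ⁻¹'
      (Set.pi univ fun i => Metric.ball (P.1 i) r)) ×ˢ Metric.ball P.2 (r ^ 2) := by
    ext Q; simp [mem_cube, Real.dist_eq]
  rw [this, Measure.volume_eq_prod, Measure.prod_prod,
    (PiLp.volume_preserving_ofLp (Fin m)).measure_preimage
      (MeasurableSet.univ_pi fun i => measurableSet_ball).nullMeasurableSet,
    volume_pi_pi, Real.volume_ball]
  simp only [Real.volume_ball, Finset.prod_const, Finset.card_univ, Fintype.card_fin]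
  rw [← ENNReal.ofReal_pow (by positivity), ← ENNReal.ofReal_mul (by positivity)]
  congr 1; ring

/-- A preconnected set which meets an open set, but not its boundary, lies in the open set. -/
lemma subset_of_disjoint_frontier {X : Type*} [TopologicalSpace X] {U C : Set X} (hU : IsOpen U)
    (hC : IsPreconnected C) (hne : (C ∩ U).Nonempty) (hd : ∀ x ∈ C, x ∉ frontier U) : C ⊆ U := by
  refine hC.subset_left_of_subset_union hU (isClosed_closure (s := U)).isOpen_compl ?_ ?_ hne
  · exact disjoint_left.2 fun x hx hx' => hx' (subset_closure hx)
  · intro x hx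
    by_cases h : x ∈ U
    · exact Or.inl h
    · exact Or.inr fun hc => hd x hx ⟨hc, by rwa [hU.interior_eq]⟩

lemma notMem_of_mem_frontier {X : Type*} [TopologicalSpace X] {U : Set X} (hU : IsOpen U) {x : X}
    (hx : x ∈ frontier U) : x ∉ U := by
  rw [← hU.interior_eq]; exact hx.2

/-! ### The splitting of the space coordinates -/

/-- The point with projection `y` and last coordinate `h`. -/
noncomputable def emb {m : ℕ} (y : SpaceTime m) (h : ℝ) : SpaceTime (m + 1) :=
  (WithLp.toLp 2 (Fin.snoc (α := fun _ => ℝ) (fun i => y.1 i) h), y.2)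

@[simp] lemma proj_emb {m : ℕ} (y : SpaceTime m) (h : ℝ) : proj (emb y h) = y := by
  refine Prod.ext ?_ rfl
  ext i; simp [proj, emb]

@[simp] lemma lastCoord_emb {m : ℕ} (y : SpaceTime m) (h : ℝ) : lastCoord (emb y h) = h := by
  simp [lastCoord, emb]

@[simp] lemma emb_proj_lastCoord {m : ℕ} (P : SpaceTime (m + 1)) :
    emb (proj P) (lastCoord P) = P := by
  refine Prod.ext ?_ rfl
  ext i
  refine Fin.lastCases ?_ (fun j => ?_) i <;> simp [proj, emb, lastCoord]

lemma mem_cube_succ {m : ℕ} {P Q : SpaceTime (m + 1)} {r : ℝ} :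
    Q ∈ cube P r ↔ proj Q ∈ cube (proj P) r ∧ |lastCoord Q - lastCoord P| < r := by
  simp only [mem_cube, Fin.forall_fin_succ', proj, lastCoord]
  tauto

lemma continuous_emb {m : ℕ} : Continuous fun p : SpaceTime m × ℝ => emb p.1 p.2 := by
  unfold emb
  refine Continuous.prodMk ?_ (by fun_prop)
  refine (PiLp.continuous_toLp 2 _).comp (continuous_pi fun i => ?_)
  refine Fin.lastCases ?_ (fun j => ?_) i
  · simpa using continuous_snd
  · simp only [Fin.snoc_castSucc]; fun_prop

lemma continuous_proj {m : ℕ} : Continuous (proj (m := m)) := by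
  unfold proj
  refine Continuous.prodMk ?_ (by fun_prop)
  exact (PiLp.continuous_toLp 2 _).comp (continuous_pi fun i => by fun_prop)

lemma continuous_lastCoord {m : ℕ} : Continuous (lastCoord (m := m)) := by
  unfold lastCoord; fun_prop

/-! ### Covering properties of Ahlfors-David regular sets -/

/-- Every surface cube has coverings by small cubes with controlled total size. -/
def CubeCoverable {n : ℕ} (S : Set (SpaceTime n)) (C : ℝ) : Prop :=
  ∀ P ∈ S, ∀ R : ℝ, 0 < R → ∀ δ : ℝ, 0 < δ → ∃ (c : ℕ → SpaceTime n) (r : ℕ → ℝ),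
    (∀ l, 0 ≤ r l ∧ r l ≤ δ) ∧ S ∩ cube P R ⊆ ⋃ l, cube (c l) (r l) ∧
      ∑' l, ENNReal.ofReal (r l ^ (n + 1)) ≤ ENNReal.ofReal (C * R ^ (n + 1))

/-- Every covering of a surface cube by cubes has total size bounded below. -/
def CubeContent {n : ℕ} (S : Set (SpaceTime n)) (a : ℝ) : Prop :=
  ∀ P ∈ S, ∀ R : ℝ, 0 < R → ∀ (c : ℕ → SpaceTime n) (r : ℕ → ℝ), (∀ l, 0 ≤ r l) →
    S ∩ cube P R ⊆ ⋃ l, cube (c l) (r l) →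
      ENNReal.ofReal (a * R ^ (n + 1)) ≤ ∑' l, ENNReal.ofReal (r l ^ (n + 1))

lemma T1_exists {n : ℕ} {S : Set (SpaceTime n)} (h : T1 S = ⊤) (a : ℝ) : ∃ P ∈ S, a < P.2 := by
  have : (a : EReal) < T1 S := h ▸ EReal.coe_lt_top a
  simp only [T1, lt_iSup_iff] at this
  obtain ⟨P, hP, hlt⟩ := this
  exact ⟨P, hP, by exact_mod_cast hlt⟩

/-- Unbounded times force infinite diameter, so the restriction `r < diam S` in the definitions is
void. -/
lemma ofReal_lt_pdiam {n : ℕ} {S : Set (SpaceTime n)} (h : T1 S = ⊤) (r : ℝ) :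
    ENNReal.ofReal r < pdiam S := by
  obtain ⟨P, hP, -⟩ := T1_exists h 0
  obtain ⟨Q, hQ, hlt⟩ := T1_exists h (P.2 + (|r| + 1) ^ 2)
  have h1 : |r| + 1 ≤ pdist P Q := by
    have : |r| + 1 ≤ Real.sqrt |P.2 - Q.2| := by
      refine Real.le_sqrt_of_sq_le ?_
      rw [abs_sub_comm]
      exact le_trans (by linarith) (le_abs_self _)
    unfold pdist; linarith [norm_nonneg (P.1 - Q.1)]
  have h2 : ENNReal.ofReal (pdist P Q) ≤ pdiam S :=
    le_iSup₂_of_le P hP (le_iSup₂_of_le Q hQ le_rfl)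
  refine lt_of_lt_of_le ?_ h2
  rw [ENNReal.ofReal_lt_ofReal_iff] <;> linarith [le_abs_self r, abs_nonneg r]

lemma slab_eq_univ {n : ℕ} {S : Set (SpaceTime n)} (h0 : T0 S = ⊥) (h1 : T1 S = ⊤) :
    slab S = univ := by
  ext P; simp [slab, h0, h1]

lemma le_pdiam_cube {n : ℕ} (P : SpaceTime n) {r : ℝ} (hr : 0 < r) :
    ENNReal.ofReal (r / 2) ≤ pdiam (cube P r) := by
  have hQ : (P.1, P.2 + (r / 2) ^ 2) ∈ cube P r := by
    refine ⟨fun i => by simpa using hr, ?_⟩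
    simp only [add_sub_cancel_left, abs_of_nonneg (sq_nonneg (r / 2))]
    nlinarith
  refine le_trans (ENNReal.ofReal_le_ofReal ?_)
    (le_iSup₂_of_le P (self_mem_cube P hr) (le_iSup₂_of_le _ hQ le_rfl))
  simpa [pdist, Real.sqrt_sq_eq_abs] using le_abs_self (r / 2)

/-- A cube of radius `r` has diameter at least `r / 2`, which gives the factor `2 ^ (n + 1)` when
diameters are traded for radii. -/
lemma exists_cover_of_hausdorff_lt {n : ℕ} {E : Set (SpaceTime n)} {B : ℝ≥0∞}
    (h : surf E < B) {δ : ℝ} (hδ : 0 < δ) :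
    ∃ (c : ℕ → SpaceTime n) (r : ℕ → ℝ), (∀ l, 0 ≤ r l ∧ r l ≤ δ) ∧ E ⊆ ⋃ l, cube (c l) (r l) ∧
      ∑' l, ENNReal.ofReal (r l ^ (n + 1)) ≤ ENNReal.ofReal (2 ^ (n + 1)) * B := by
  have hδ' : 0 < ENNReal.ofReal (δ / 2) := by simpa using hδ
  have h1 : hausdorffPre n ((n : ℝ) + 1) (ENNReal.ofReal (δ / 2)) E < B := by
    refine lt_of_le_of_lt ?_ h
    have : hausdorffPre n ((n : ℝ) + 1) (ENNReal.ofReal (δ / 2)) ≤ hausdorff n ((n : ℝ) + 1) :=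
      le_iSup₂_of_le _ hδ' le_rfl
    exact this E
  rw [hausdorffPre, OuterMeasure.boundedBy_apply] at h1
  simp only [iInf_lt_iff] at h1
  obtain ⟨t, ht, hlt⟩ := h1
  have key : ∀ l, ∃ (c : SpaceTime n) (r : ℝ), (0 ≤ r ∧ r ≤ δ) ∧ t l ⊆ cube c r ∧
      ENNReal.ofReal (r ^ (n + 1)) ≤ ENNReal.ofReal (2 ^ (n + 1)) *
        ⨆ _ : (t l).Nonempty, ⨅ (_ : IsCube (t l))
          (_ : pdiam (t l) ≤ ENNReal.ofReal (δ / 2)), pdiam (t l) ^ ((n : ℝ) + 1) := by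
    intro l
    by_cases hne : (t l).Nonempty
    -- A term of a finite sum is finite, and this forces the nonempty piece `t l` to be a cube of
    -- small diameter; empty pieces become cubes of radius `0`, which are empty.
    · have hfin : (⨆ _ : (t l).Nonempty, ⨅ (_ : IsCube (t l))
          (_ : pdiam (t l) ≤ ENNReal.ofReal (δ / 2)), pdiam (t l) ^ ((n : ℝ) + 1)) < ⊤ :=
        lt_of_le_of_lt (ENNReal.le_tsum l) (hlt.trans_le le_top)
      simp only [hne, iSup_pos, iInf_lt_iff] at hfin ⊢
      obtain ⟨hc, hd, -⟩ := hfin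
      obtain ⟨P, r, hr, hP⟩ := id hc
      have h3 : ENNReal.ofReal (r / 2) ≤ pdiam (t l) := by rw [hP]; exact le_pdiam_cube P hr
      refine ⟨P, r, ⟨hr.le, ?_⟩, hP.le, ?_⟩
      · have := (ENNReal.ofReal_le_ofReal_iff (by positivity)).1 (h3.trans hd)
        linarith
      · simp only [hc, hd, iInf_pos]
        rw [show (n : ℝ) + 1 = ((n + 1 : ℕ) : ℝ) by push_cast; ring, ENNReal.rpow_natCast]
        calc ENNReal.ofReal (r ^ (n + 1))
            = ENNReal.ofReal (2 ^ (n + 1)) * ENNReal.ofReal (r / 2) ^ (n + 1) := by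
              rw [← ENNReal.ofReal_pow (by positivity), ← ENNReal.ofReal_mul (by positivity),
                ← mul_pow]
              congr 2; ring
          _ ≤ _ := by gcongr
    · rw [not_nonempty_iff_eq_empty] at hne
      exact ⟨0, 0, ⟨le_rfl, hδ.le⟩, by simp [hne], by simp⟩
  choose c r hr hsub hle using key
  refine ⟨c, r, hr, ht.trans (iUnion_mono hsub), ?_⟩
  calc _ ≤ _ := ENNReal.tsum_le_tsum hle
    _ = _ := ENNReal.tsum_mul_left
    _ ≤ _ := by gcongr

lemma cubeCoverable_of_surf_le {n : ℕ} {S : Set (SpaceTime n)} {M : ℝ} (hM : 0 < M)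
    (h : ∀ P ∈ S, ∀ r : ℝ, 0 < r → surf (surfCube S P r) ≤ ENNReal.ofReal (M * r ^ (n + 1))) :
    CubeCoverable S (2 ^ (n + 1) * (2 * M)) := by
  intro P hP R hR δ hδ
  have hlt : surf (S ∩ cube P R) < ENNReal.ofReal (2 * M * R ^ (n + 1)) := by
    refine lt_of_le_of_lt (h P hP R hR) ?_
    rw [ENNReal.ofReal_lt_ofReal_iff (by positivity)]
    have : 0 < M * R ^ (n + 1) := by positivity
    linarith
  obtain ⟨c, r, hr, hsub, hle⟩ := exists_cover_of_hausdorff_lt hlt hδ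
  refine ⟨c, r, hr, hsub, hle.trans_eq ?_⟩
  rw [← ENNReal.ofReal_mul (by positivity)]
  congr 1; ring

lemma surf_inter_cube_le {n : ℕ} {S : Set (SpaceTime n)} {M : ℝ}
    (h : ∀ P ∈ S, ∀ r : ℝ, 0 < r → surf (surfCube S P r) ≤ ENNReal.ofReal (M * r ^ (n + 1)))
    (c : SpaceTime n) {r : ℝ} (hr : 0 ≤ r) :
    surf (S ∩ cube c r) ≤ ENNReal.ofReal (M * 2 ^ (n + 1)) * ENNReal.ofReal (r ^ (n + 1)) := by
  rcases (S ∩ cube c r).eq_empty_or_nonempty with he | ⟨q, hqS, hq⟩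
  · rw [he]; simp [surf]
  have hr' : 0 < r := by
    rcases hr.eq_or_lt with h0 | h0
    · have := hq.2; rw [← h0] at this
      exact absurd this (by simp)
    · exact h0
  have hsub : S ∩ cube c r ⊆ surfCube S q (2 * r) := fun x hx => ⟨hx.1,
    mem_cube_trans (mem_cube_comm.1 hq) hx.2 (by linarith) (by nlinarith)⟩
  calc surf (S ∩ cube c r) ≤ surf (surfCube S q (2 * r)) := measure_mono hsub
    _ ≤ _ := h q hqS _ (by positivity)
    _ = _ := by
      rw [← ENNReal.ofReal_mul' (by positivity)]; congr 1; rw [mul_pow]; ring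

/-- Countable subadditivity: a covering cube that meets `S` lies in a surface cube of twice its
radius, whose measure is bounded by the upper regularity. -/
lemma cubeContent_of_isADR {n : ℕ} {S : Set (SpaceTime n)} {M : ℝ} (hM : 0 < M)
    (h : ∀ P ∈ S, ∀ r : ℝ, 0 < r → surf (surfCube S P r) ≤ ENNReal.ofReal (M * r ^ (n + 1)))
    (h' : ∀ P ∈ S, ∀ r : ℝ, 0 < r →
      ENNReal.ofReal (M⁻¹ * r ^ (n + 1)) ≤ surf (surfCube S P r)) :
    CubeContent S ((M * 2 ^ (n + 1))⁻¹ * M⁻¹) := by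
  intro P hP R hR c r hr hsub
  have h1 : surf (S ∩ cube P R) ≤
      ENNReal.ofReal (M * 2 ^ (n + 1)) * ∑' l, ENNReal.ofReal (r l ^ (n + 1)) := by
    calc surf (S ∩ cube P R) ≤ surf (⋃ l, S ∩ cube (c l) (r l)) := by
          refine measure_mono fun x hx => ?_
          obtain ⟨l, hl⟩ := mem_iUnion.1 (hsub hx)
          exact mem_iUnion.2 ⟨l, hx.1, hl⟩
      _ ≤ ∑' l, surf (S ∩ cube (c l) (r l)) := measure_iUnion_le _
      _ ≤ ∑' l, ENNReal.ofReal (M * 2 ^ (n + 1)) * ENNReal.ofReal (r l ^ (n + 1)) :=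
          ENNReal.tsum_le_tsum fun l => surf_inter_cube_le h _ (hr l)
      _ = _ := ENNReal.tsum_mul_left
  have h2 := (h' P hP R hR).trans h1
  have hpos : 0 < M * 2 ^ (n + 1) := by positivity
  rw [mul_assoc, ENNReal.ofReal_mul (by positivity), ENNReal.ofReal_inv_of_pos hpos]
  exact (ENNReal.inv_mul_le_iff (by simpa using hpos) ENNReal.ofReal_ne_top).2 h2

/-! ### Moving in time along a time-symmetric set -/

/-- The sign `sg` is the direction of time. If the half cube stayed in a layer of thickness `R ^ 2 /
k ^ 2`, then `k ^ n` surface cubes of radius `2 * R / k` would cover it; their total measure is of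
order `R ^ (n + 1) / k`, too small for the lower bound. -/
lemma exists_time_step {n : ℕ} {S : Set (SpaceTime n)} {M M' sg : ℝ} (hM : 0 < M) (hM' : 0 < M')
    (hsg : |sg| = 1)
    (h : ∀ P ∈ S, ∀ r : ℝ, 0 < r → surf (surfCube S P r) ≤ ENNReal.ofReal (M * r ^ (n + 1)))
    (h' : ∀ P ∈ S, ∀ r : ℝ, 0 < r → ENNReal.ofReal (M'⁻¹ * r ^ (n + 1)) ≤
      surf (surfCube S P r ∩ {Q | 0 ≤ sg * (Q.2 - P.2)}))
    {k : ℕ} (hk : M * M' * 2 ^ (n + 1) < k) {P : SpaceTime n} (hP : P ∈ S) {R : ℝ} (hR : 0 < R) :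
    ∃ Q ∈ S, Q ∈ cube P R ∧ R ^ 2 / k ^ 2 ≤ sg * (Q.2 - P.2) := by
  by_contra! hcon
  have hk0 : (0 : ℝ) < k := lt_trans (by positivity) hk
  have hkR : 0 < 2 * R / k := by positivity
  set E := surfCube S P R ∩ {Q | 0 ≤ sg * (Q.2 - P.2)} with hE
  let G : (Fin n → Fin k) → Set (SpaceTime n) := fun f =>
    {Q ∈ E | ∀ i, ((f i : ℕ) : ℝ) * (2 * R / k) ≤ Q.1 i - P.1 i + R ∧
      Q.1 i - P.1 i + R < (((f i : ℕ) : ℝ) + 1) * (2 * R / k)}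
  have hcov : E ⊆ ⋃ f, G f := by
    intro Q hQ
    have hb : ∀ i, 0 ≤ (Q.1 i - P.1 i + R) / (2 * R / k) ∧
        (Q.1 i - P.1 i + R) / (2 * R / k) < k := by
      intro i
      have := abs_lt.1 (hQ.1.2.1 i)
      refine ⟨div_nonneg (by linarith) hkR.le, ?_⟩
      rw [div_lt_iff₀ hkR, mul_div_cancel₀ _ hk0.ne']
      linarith
    refine mem_iUnion.2 ⟨fun i => ⟨⌊(Q.1 i - P.1 i + R) / (2 * R / k)⌋₊,
      (Nat.floor_lt (hb i).1).2 (hb i).2⟩, hQ, fun i => ⟨?_, ?_⟩⟩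
    · rw [← le_div_iff₀ hkR]; exact Nat.floor_le (hb i).1
    · rw [← div_lt_iff₀ hkR]; exact Nat.lt_floor_add_one _
  have hG : ∀ f, surf (G f) ≤ ENNReal.ofReal (M * (2 * R / k) ^ (n + 1)) := by
    intro f
    rcases (G f).eq_empty_or_nonempty with he | ⟨q, hqE, hq⟩
    · rw [he]; simp [surf]
    refine le_trans (measure_mono ?_) (h q hqE.1.1 _ hkR)
    rintro x ⟨hxE, hx⟩
    refine ⟨hxE.1.1, fun i => ?_, ?_⟩
    · rw [abs_lt]
      constructor <;> nlinarith [hx i, hq i]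
    · have h1 := hcon x hxE.1.1 hxE.1.2
      have h2 := hcon q hqE.1.1 hqE.1.2
      have h3 : 0 ≤ sg * (x.2 - P.2) := hxE.2
      have h4 : 0 ≤ sg * (q.2 - P.2) := hqE.2
      have h5 : |x.2 - q.2| = |sg * (x.2 - P.2) - sg * (q.2 - P.2)| := by
        rw [← mul_sub, abs_mul, hsg]; simp
      have h6 : 0 < R ^ 2 / k ^ 2 := by positivity
      have h7 : (2 * R / k) ^ 2 = 4 * (R ^ 2 / k ^ 2) := by field_simp; norm_num
      rw [h5, h7, abs_lt]
      constructor <;> linarith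
  have hsum : surf E ≤ ENNReal.ofReal (k ^ n * (M * (2 * R / k) ^ (n + 1))) := by
    calc surf E ≤ surf (⋃ f, G f) := measure_mono hcov
      _ ≤ ∑' f, surf (G f) := measure_iUnion_le _
      _ ≤ ∑' _ : Fin n → Fin k, ENNReal.ofReal (M * (2 * R / k) ^ (n + 1)) :=
          ENNReal.tsum_le_tsum hG
      _ = _ := by
          rw [tsum_fintype, Finset.sum_const, Finset.card_univ, nsmul_eq_mul,
            ENNReal.ofReal_mul (p := (k : ℝ) ^ n) (by positivity)]
          simp
  have hfin := (h' P hP R hR).trans hsum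
  rw [ENNReal.ofReal_le_ofReal_iff (by positivity)] at hfin
  have e1 : (k : ℝ) ^ n * (M * (2 * R / k) ^ (n + 1)) = M * 2 ^ (n + 1) / k * R ^ (n + 1) := by
    rw [div_pow, mul_pow, pow_succ (k : ℝ)]; field_simp
  rw [e1] at hfin
  have h8 := le_of_mul_le_mul_right hfin (by positivity)
  rw [le_div_iff₀ hk0, inv_mul_le_iff₀ hM'] at h8
  nlinarith

/-- Each step advances time by at least `a` but by less than `R ^ 2`. A walk that stops once it is
within `R ^ 2` of `τ` therefore never jumps over `τ`. -/
lemma exists_time_near_aux {n : ℕ} {S : Set (SpaceTime n)} {sg R a τ : ℝ} (hsg : |sg| = 1)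
    (hR : 0 < R)
    (hstep : ∀ P ∈ S, ∃ Q ∈ S, Q ∈ cube P R ∧ a ≤ sg * (Q.2 - P.2)) (N : ℕ) :
    ∀ P ∈ S, 0 ≤ sg * (τ - P.2) → sg * (τ - P.2) ≤ N * a →
      ∃ Q ∈ S, |Q.2 - τ| ≤ R ^ 2 ∧ ∀ i, |Q.1 i - P.1 i| ≤ N * R := by
  have habs : ∀ x : ℝ, |x| = |sg * x| := fun x => by rw [abs_mul, hsg, one_mul]
  induction N with
  | zero =>
    intro P hP h0 h1
    refine ⟨P, hP, ?_, by simp⟩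
    rw [abs_sub_comm, habs, abs_of_nonneg h0]
    simp only [CharP.cast_eq_zero, zero_mul] at h1
    exact h1.trans (sq_nonneg R)
  | succ N ih =>
    intro P hP h0 h1
    by_cases hlt : sg * (τ - P.2) ≤ R ^ 2
    · refine ⟨P, hP, ?_, fun i => ?_⟩
      · rwa [abs_sub_comm, habs, abs_of_nonneg h0]
      · simp only [sub_self, abs_zero]; positivity
    · push Not at hlt
      obtain ⟨P', hP', hc, ha⟩ := hstep P hP
      have h2 : sg * (P'.2 - P.2) < R ^ 2 := by
        have := hc.2
        rw [habs] at this
        exact (le_abs_self _).trans_lt this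
      have e : sg * (τ - P'.2) = sg * (τ - P.2) - sg * (P'.2 - P.2) := by ring
      obtain ⟨Q, hQ, hq1, hq2⟩ := ih P' hP' (by linarith) (by push_cast at h1; linarith)
      refine ⟨Q, hQ, hq1, fun i => ?_⟩
      have := abs_sub_le (Q.1 i) (P'.1 i) (P.1 i)
      push_cast
      linarith [hq2 i, hc.1 i]

/-- On a time-symmetric set one can reach any prescribed time, up to an error `R²`, moving a
distance controlled by the time difference. -/
lemma exists_time_near {n : ℕ} {S : Set (SpaceTime n)} {M M' : ℝ} (hM : 0 < M) (hM' : 0 < M')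
    (h : ∀ P ∈ S, ∀ r : ℝ, 0 < r → surf (surfCube S P r) ≤ ENNReal.ofReal (M * r ^ (n + 1)))
    (hf : ∀ P ∈ S, ∀ r : ℝ, 0 < r → ENNReal.ofReal (M'⁻¹ * r ^ (n + 1)) ≤
      surf (surfCube S P r ∩ {Q | P.2 ≤ Q.2}))
    (hb : ∀ P ∈ S, ∀ r : ℝ, 0 < r → ENNReal.ofReal (M'⁻¹ * r ^ (n + 1)) ≤
      surf (surfCube S P r ∩ {Q | Q.2 ≤ P.2}))
    {k : ℕ} (hk : M * M' * 2 ^ (n + 1) < k) {P : SpaceTime n} (hP : P ∈ S) {R τ : ℝ}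
    (hR : 0 < R) {N : ℕ} (hN : |τ - P.2| ≤ N * (R ^ 2 / k ^ 2)) :
    ∃ Q ∈ S, |Q.2 - τ| ≤ R ^ 2 ∧ ∀ i, |Q.1 i - P.1 i| ≤ N * R := by
  rcases le_total 0 (τ - P.2) with h0 | h0
  · refine exists_time_near_aux (sg := 1) (by simp) hR
      (fun P hP => exists_time_step hM hM' (by simp) h ?_ hk hP hR) N P hP (by simpa using h0) ?_
    · simpa using hf
    · simpa [abs_of_nonneg h0] using hN
  · refine exists_time_near_aux (sg := -1) (by simp) hR
      (fun P hP => exists_time_step hM hM' (by simp) h ?_ hk hP hR) N P hP (by linarith) ?_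
    · simpa using hb
    · rw [abs_of_nonpos h0] at hN; linarith

/-! ### Packing of disjoint surface cubes -/

lemma exists_pos_le_finset {ι : Type*} (F : Finset ι) (s : ι → ℝ) (hs : ∀ i ∈ F, 0 < s i) :
    ∃ δ : ℝ, 0 < δ ∧ ∀ i ∈ F, δ ≤ s i := by
  classical
  induction F using Finset.induction_on with
  | empty => exact ⟨1, one_pos, by simp⟩
  | insert a F _ ih =>
    obtain ⟨δ, hδ, h⟩ := ih fun i hi => hs i (Finset.mem_insert_of_mem hi)
    refine ⟨min δ (s a), lt_min hδ (hs a (Finset.mem_insert_self _ _)), fun i hi => ?_⟩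
    rcases Finset.mem_insert.1 hi with rfl | hi
    · exact min_le_right _ _
    · exact (min_le_left _ _).trans (h i hi)

/-- Cover `S ∩ cube P R` by cubes of radius at most every `s i / 4`. One that meets the half cube at
`q i` stays in the full cube, so by disjointness it serves a single `i`; the content bounds can then
be summed. -/
lemma sum_packing_le {n : ℕ} {S : Set (SpaceTime n)} {C a : ℝ} (hC : CubeCoverable S C)
    (ha : CubeContent S a) {P : SpaceTime n} (hP : P ∈ S) {R : ℝ} (hR : 0 < R) {ι : Type*}
    (F : Finset ι) (q : ι → SpaceTime n) (s : ι → ℝ) (hs : ∀ i ∈ F, 0 < s i)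
    (hq : ∀ i ∈ F, q i ∈ S) (hsub : ∀ i ∈ F, cube (q i) (s i) ⊆ cube P R)
    (hdisj : ∀ i ∈ F, ∀ j ∈ F, i ≠ j → Disjoint (cube (q i) (s i)) (cube (q j) (s j))) :
    ∑ i ∈ F, ENNReal.ofReal (a * (s i / 2) ^ (n + 1)) ≤ ENNReal.ofReal (C * R ^ (n + 1)) := by
  classical
  obtain ⟨δ, hδ, hδs⟩ := exists_pos_le_finset F (fun i => s i / 4)
    fun i hi => by have := hs i hi; positivity
  obtain ⟨c, r, hr, hcov, hsum⟩ := hC P hP R hR δ hδ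
  let p : ι → ℕ → Prop := fun i l => (cube (c l) (r l) ∩ cube (q i) (s i / 2)).Nonempty
  have hp : ∀ i ∈ F, ∀ l, p i l → cube (c l) (r l) ⊆ cube (q i) (s i) := by
    rintro i hi l ⟨x, hx1, hx2⟩ y hy
    have h1 := hδs i hi
    have h2 := hr l
    have h3 : y ∈ cube x (2 * r l) :=
      mem_cube_trans (mem_cube_comm.1 hx1) hy (by linarith) (by nlinarith)
    exact mem_cube_trans hx2 h3 (by linarith) (by nlinarith)
  have h1 : ∀ i ∈ F, ENNReal.ofReal (a * (s i / 2) ^ (n + 1)) ≤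
      ∑' l, ENNReal.ofReal ((if p i l then r l else 0) ^ (n + 1)) := by
    -- Cubes of the cover that do not serve `i` are given radius `0`, hence become empty without
    -- affecting the covering of the half cube.
    intro i hi
    refine ha (q i) (hq i hi) (s i / 2) (by have := hs i hi; positivity) c _
      (fun l => by split_ifs; exacts [(hr l).1, le_rfl]) ?_
    rintro x ⟨hxS, hx⟩
    have hx' : x ∈ cube P R := hsub i hi
      (cube_mono _ (by linarith [hs i hi]) (by linarith [hs i hi]) hx)
    obtain ⟨l, hl⟩ := mem_iUnion.1 (hcov ⟨hxS, hx'⟩)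
    refine mem_iUnion.2 ⟨l, ?_⟩
    have : p i l := ⟨x, hl, hx⟩
    simpa only [this, if_true] using hl
  have h2 : ∀ l, ∑ i ∈ F, ENNReal.ofReal ((if p i l then r l else 0) ^ (n + 1)) ≤
      ENNReal.ofReal (r l ^ (n + 1)) := by
    intro l
    by_cases hex : ∃ i ∈ F, p i l
    · obtain ⟨i, hi, hpi⟩ := hex
      rw [Finset.sum_eq_single_of_mem i hi]
      · simp [hpi]
      · intro j hj hji
        by_cases hpj : p j l
        · exfalso
          obtain ⟨x, hx, -⟩ := id hpi
          exact disjoint_left.1 (hdisj i hi j hj hji.symm) (hp i hi l hpi hx) (hp j hj l hpj hx)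
        · simp [hpj]
    · push Not at hex
      rw [Finset.sum_eq_zero fun i hi => by simp [hex i hi]]
      exact zero_le
  calc _ ≤ ∑ i ∈ F, ∑' l, ENNReal.ofReal ((if p i l then r l else 0) ^ (n + 1)) :=
        Finset.sum_le_sum h1
    _ = ∑' l, ∑ i ∈ F, ENNReal.ofReal ((if p i l then r l else 0) ^ (n + 1)) :=
        (Summable.tsum_finsetSum fun _ _ => ENNReal.summable).symm
    _ ≤ _ := ENNReal.tsum_le_tsum h2
    _ ≤ _ := hsum

/-! ### Vertical stacks -/

/-- The points `y` above which there is a stack of `k` well separated points of `S`. -/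
def stacked {m : ℕ} (S : Set (SpaceTime (m + 1))) (P : SpaceTime (m + 1)) (R s₀ : ℝ) (k : ℕ) :
    Set (SpaceTime m) :=
  {y | ∃ s : ℝ, 0 < s ∧ s ≤ s₀ ∧ ∃ q : Fin k → SpaceTime (m + 1),
    (∀ i, q i ∈ S ∧ proj (q i) ∈ cube y (2 * s) ∧ cube (q i) s ⊆ cube P R) ∧
      ∀ i j, i ≠ j → 2 * s ≤ |lastCoord (q i) - lastCoord (q j)|}

lemma volume_stacked_le {m : ℕ} {S : Set (SpaceTime (m + 1))} {C a : ℝ}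
    (hC : CubeCoverable S C) (ha : CubeContent S a) (ha0 : 0 < a) {P : SpaceTime (m + 1)}
    (hP : P ∈ S) {R : ℝ} (hR : 0 < R) (s₀ : ℝ) (k : ℕ) :
    k * volume (stacked S P R s₀ k) ≤
      ENNReal.ofReal (2 ^ (m + 1) * 18 ^ (m + 2) / a * (C * R ^ (m + 2))) := by
  classical
  choose! s hs0 hs1 q hq hsep using
    show ∀ y ∈ stacked S P R s₀ k, ∃ s : ℝ, 0 < s ∧ s ≤ s₀ ∧ ∃ q : Fin k → SpaceTime (m + 1),
      (∀ i, q i ∈ S ∧ proj (q i) ∈ cube y (2 * s) ∧ cube (q i) s ⊆ cube P R) ∧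
        ∀ i j, i ≠ j → 2 * s ≤ |lastCoord (q i) - lastCoord (q j)| from fun y hy => hy
  -- The radius `3 * s y` is large enough to contain the projections of all cubes `cube (q y i) (s
  -- y)`. With ratio `2` in Vitali's lemma the enlarged radius is `3 + 2 * 3 = 9` times `s b`.
  obtain ⟨u, hut, hdisj, hcov⟩ := Vitali.exists_disjoint_subfamily_covering_enlargement
    (fun y => cube y (3 * s y)) (stacked S P R s₀ k) s 2 one_lt_two (fun y hy => (hs0 y hy).le)
    s₀ hs1 (fun y hy => ⟨y, self_mem_cube y (by linarith [hs0 y hy])⟩)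
  have hcount : u.Countable := hdisj.countable_of_isOpen (fun y _ => isOpen_cube _ _)
    (fun y hy => ⟨y, self_mem_cube y (by linarith [hs0 y (hut hy)])⟩)
  have hsub : stacked S P R s₀ k ⊆ ⋃ b ∈ u, cube b (9 * s b) := by
    intro x hx
    obtain ⟨b, hb, ⟨z, hz1, hz2⟩, hle⟩ := hcov x hx
    have h0 := hs0 x hx
    have h1 := hs0 b (hut hb)
    refine mem_iUnion₂.2 ⟨b, hb, mem_cube_trans hz2 (mem_cube_comm.1 hz1) (by linarith) ?_⟩
    nlinarith
  have hpack : ∀ F : Finset u, ∑ b ∈ F, (k : ℝ≥0∞) * ENNReal.ofReal (a * (s b / 2) ^ (m + 2)) ≤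
      ENNReal.ofReal (C * R ^ (m + 2)) := by
    intro F
    have key := sum_packing_le hC ha hP hR (F ×ˢ (Finset.univ : Finset (Fin k)))
      (fun x => q x.1 x.2) (fun x => s x.1) (fun x _ => hs0 _ (hut x.1.2))
      (fun x _ => (hq _ (hut x.1.2) _).1) (fun x _ => (hq _ (hut x.1.2) _).2.2) ?_
    · rw [Finset.sum_product] at key
      simpa using key
    · rintro ⟨b, i⟩ - ⟨b', i'⟩ - hne
      have hb0 := hs0 _ (hut b.2)
      have hb0' := hs0 _ (hut b'.2)
      rw [disjoint_left]
      intro x hx hx'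
      simp only [mem_cube_succ] at hx hx'
      -- In one stack the cubes are disjoint because of their heights, in different stacks because
      -- of their projections.
      by_cases hbb : b = b'
      · subst hbb
        have hii : i ≠ i' := fun h => hne (by rw [h])
        have h1 := hsep _ (hut b.2) i i' hii
        have h2 := abs_sub_le (lastCoord (q b i)) (lastCoord x) (lastCoord (q b i'))
        rw [abs_sub_comm (lastCoord (q b i)) (lastCoord x)] at h2
        linarith [hx.2, hx'.2]
      · have h1 : proj x ∈ cube (b : SpaceTime m) (3 * s b) :=
          mem_cube_trans (hq _ (hut b.2) i).2.1 hx.1 (by linarith) (by nlinarith)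
        have h2 : proj x ∈ cube (b' : SpaceTime m) (3 * s b') :=
          mem_cube_trans (hq _ (hut b'.2) i').2.1 hx'.1 (by linarith) (by nlinarith)
        exact disjoint_left.1 (hdisj b.2 b'.2 (fun h => hbb (Subtype.ext h))) h1 h2
  have htsum : ∑' b : u, (k : ℝ≥0∞) * ENNReal.ofReal (a * (s b / 2) ^ (m + 2)) ≤
      ENNReal.ofReal (C * R ^ (m + 2)) := by
    rw [ENNReal.tsum_eq_iSup_sum]
    exact iSup_le hpack
  have : Countable u := hcount
  calc k * volume (stacked S P R s₀ k) ≤ k * ∑' b : u, volume (cube (b : SpaceTime m) (9 * s b)) := by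
        gcongr
        refine (measure_mono hsub).trans ?_
        rw [biUnion_eq_iUnion]
        exact measure_iUnion_le _
    _ = ENNReal.ofReal (2 ^ (m + 1) * 18 ^ (m + 2) / a) *
          ∑' b : u, (k : ℝ≥0∞) * ENNReal.ofReal (a * (s b / 2) ^ (m + 2)) := by
        rw [← ENNReal.tsum_mul_left, ← ENNReal.tsum_mul_left]
        refine tsum_congr fun b => ?_
        have hb0 := hs0 _ (hut b.2)
        rw [volume_cube _ (by positivity), mul_left_comm, ← ENNReal.ofReal_mul (by positivity)]
        congr 2
        rw [show (18 : ℝ) = 9 * 2 by norm_num]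
        simp only [mul_pow, div_pow]
        field_simp
    _ ≤ ENNReal.ofReal (2 ^ (m + 1) * 18 ^ (m + 2) / a) * ENNReal.ofReal (C * R ^ (m + 2)) := by
        gcongr
    _ = _ := by rw [← ENNReal.ofReal_mul (by positivity)]

/-! ### Alternating stacks of cubes -/

/-- There are `k` pairs of cubes of size `s` stacked over `y`, at heights between `h₀` and `h`,
which alternately lie in `Ω` and in the exterior of `Ω`. -/
def Alternates {m : ℕ} (Ω : Set (SpaceTime (m + 1))) (h₀ s : ℝ) (y : SpaceTime m) :
    ℕ → ℝ → Prop
  | 0, h => h₀ < h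
  | k + 1, h => ∃ g e : ℝ, g < e ∧ e < h ∧ cube (emb y g) s ⊆ Ω ∧
      cube (emb y e) s ⊆ (closure Ω)ᶜ ∧ Alternates Ω h₀ s y k g

lemma Alternates.lt {m : ℕ} {Ω : Set (SpaceTime (m + 1))} {h₀ s : ℝ} {y : SpaceTime m} :
    ∀ {k : ℕ} {h : ℝ}, Alternates Ω h₀ s y k h → h₀ < h
  | 0, _, H => H
  | _ + 1, _, ⟨_, _, hge, heh, _, _, H⟩ => (H.lt.trans hge).trans heh

lemma cube_emb_subset {m : ℕ} {y y' : SpaceTime m} {s s' : ℝ} (hs : s' ≤ s)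
    (h : cube y' s' ⊆ cube y s) (g : ℝ) : cube (emb y' g) s' ⊆ cube (emb y g) s := by
  intro x hx
  simp only [mem_cube_succ, proj_emb, lastCoord_emb] at hx ⊢
  exact ⟨h hx.1, hx.2.trans_le hs⟩

lemma Alternates.mono {m : ℕ} {Ω : Set (SpaceTime (m + 1))} {h₀ s s' : ℝ} {y y' : SpaceTime m}
    (hs : s' ≤ s) (hsub : cube y' s' ⊆ cube y s) :
    ∀ {k : ℕ} {h : ℝ}, Alternates Ω h₀ s y k h → Alternates Ω h₀ s' y' k h
  | 0, _, H => H
  | _ + 1, _, ⟨g, e, hge, heh, hg, he, H⟩ =>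
    ⟨g, e, hge, heh, (cube_emb_subset hs hsub g).trans hg, (cube_emb_subset hs hsub e).trans he,
      H.mono hs hsub⟩

/-- The boundary is crossed on a vertical segment joining a point of `Ω` to a point outside. -/
lemma exists_crossing {m : ℕ} {Ω : Set (SpaceTime (m + 1))} (hΩ : IsOpen Ω) {y : SpaceTime m}
    {g e : ℝ} (hg : emb y g ∈ Ω) (he : emb y e ∉ Ω) :
    ∃ x ∈ uIcc g e, emb y x ∈ frontier Ω := by
  by_contra! hcon
  have hc : Continuous fun h => emb y h :=
    continuous_emb.comp (continuous_const.prodMk continuous_id)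
  have hsub : (fun h => emb y h) '' uIcc g e ⊆ Ω := by
    refine subset_of_disjoint_frontier hΩ (isPreconnected_uIcc.image _ hc.continuousOn)
      ⟨_, mem_image_of_mem _ left_mem_uIcc, hg⟩ ?_
    rintro _ ⟨x, hx, rfl⟩
    exact hcon x hx
  exact he (hsub (mem_image_of_mem _ right_mem_uIcc))

/-- Each pair yields a boundary crossing at least `s` above its interior centre `g`, while the
covering cubes already used for lower pairs reach below `g`. A cube of radius at most `s / 2` is too
short to do both, so a new cube is needed for each pair. -/
lemma Alternates.exists_finset {m : ℕ} {Ω : Set (SpaceTime (m + 1))} (hΩ : IsOpen Ω) {h₀ s : ℝ}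
    (hs : 0 < s) {y : SpaceTime m} {top : ℝ} {c : ℕ → SpaceTime (m + 1)} {r : ℕ → ℝ}
    (hr : ∀ l, r l ≤ s / 2)
    (hcov : ∀ x, h₀ < x → x < top → emb y x ∈ frontier Ω → ∃ l, emb y x ∈ cube (c l) (r l)) :
    ∀ {k : ℕ} {h : ℝ}, h ≤ top → Alternates Ω h₀ s y k h →
      ∃ F : Finset ℕ, F.card = k ∧ ∀ l ∈ F, ∃ x < h, emb y x ∈ cube (c l) (r l) := by
  classical
  intro k
  induction k with
  | zero => exact fun _ _ => ⟨∅, by simp⟩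
  | succ k ih =>
    rintro h hle ⟨g, e, hge, heh, hg, he, H⟩
    obtain ⟨F, hF, hFx⟩ := ih (by linarith) H
    have hgΩ : emb y g ∈ Ω := hg (self_mem_cube _ hs)
    have heΩ : emb y e ∉ Ω := fun hc => he (self_mem_cube _ hs) (subset_closure hc)
    obtain ⟨x, hx, hxS⟩ := exists_crossing hΩ hgΩ heΩ
    rw [uIcc_of_le hge.le] at hx
    have hxg : g + s ≤ x := by
      by_contra! hlt
      refine notMem_of_mem_frontier hΩ hxS (hg ?_)
      rw [mem_cube_succ]
      simp only [proj_emb, lastCoord_emb]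
      exact ⟨self_mem_cube _ hs, by rw [abs_lt]; constructor <;> linarith [hx.1]⟩
    obtain ⟨l, hl⟩ := hcov x (by linarith [H.lt]) (by linarith [hx.2]) hxS
    have hlF : l ∉ F := by
      intro hmem
      obtain ⟨x', hx', hl'⟩ := hFx l hmem
      have h1 := abs_lt.1 (mem_cube_succ.1 hl).2
      have h2 := abs_lt.1 (mem_cube_succ.1 hl').2
      simp only [lastCoord_emb] at h1 h2
      linarith [hr l]
    refine ⟨insert l F, by rw [Finset.card_insert_of_notMem hlF, hF], fun l' hl' => ?_⟩
    rcases Finset.mem_insert.1 hl' with rfl | hl'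
    · exact ⟨x, by linarith [hx.2], hl⟩
    · obtain ⟨x', hx', hx''⟩ := hFx l' hl'
      exact ⟨x', by linarith, hx''⟩

/-- If the number of alternations over the points of `W j` grows from scale `σ j` to scale
`σ (j + 1)`, then the sets `W j` have bounded total volume. -/
lemma tsum_volume_le_of_alternates {m : ℕ} {Ω : Set (SpaceTime (m + 1))} (hΩ : IsOpen Ω)
    {C : ℝ} (hC : CubeCoverable (frontier Ω) C) {P : SpaceTime (m + 1)} (hP : P ∈ frontier Ω)
    {R : ℝ} (hR : 0 < R) {h₀ top : ℝ} (htop : h₀ < top) {I : Set (SpaceTime m)}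
    (hI : ∀ y ∈ I, ∀ x, h₀ < x → x < top → emb y x ∈ cube P R) {W : ℕ → Set (SpaceTime m)}
    (hW : ∀ j, IsOpen (W j)) (hWI : ∀ j, W j ⊆ I) {σ : ℕ → ℝ} (hσ : ∀ j, 0 < σ j)
    (hanti : Antitone σ)
    (hgrow : ∀ j, ∀ y ∈ W j, ∀ p, Alternates Ω h₀ (σ j) y p top →
      Alternates Ω h₀ (σ (j + 1)) y (p + 1) top) :
    ∑' j, volume (W j) ≤ ENNReal.ofReal (2 ^ (m + 1) * (C * R ^ (m + 2))) := by
  classical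
  -- By scale `σ J` the line over `y` has gained one alternation for each `j < J` with `y ∈ W j`; at
  -- the other scales the existing ones are merely shrunk.
  have halt : ∀ y J, Alternates Ω h₀ (σ J) y ((Finset.range J).filter fun j => y ∈ W j).card
      top := by
    intro y J
    induction J with
    | zero => simpa [Alternates] using htop
    | succ J ih =>
      rw [Finset.range_add_one, Finset.filter_insert]
      split_ifs with h
      · rw [Finset.card_insert_of_notMem (by simp)]
        exact hgrow J y h _ ih
      · exact ih.mono (hanti (Nat.le_succ J)) (cube_mono _ (hσ _).le (hanti (Nat.le_succ J)))
  refine ENNReal.tsum_le_of_sum_range_le fun J => ?_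
  obtain ⟨c, r, hr, hcov, hsum⟩ := hC P hP R hR (σ J / 2) (half_pos (hσ J))
  have hpt : ∀ y, ∑ j ∈ Finset.range J, (W j).indicator (1 : SpaceTime m → ℝ≥0∞) y ≤
      ∑' l, (cube (proj (c l)) (r l)).indicator (1 : SpaceTime m → ℝ≥0∞) y := by
    intro y
    have e1 : ∑ j ∈ Finset.range J, (W j).indicator (1 : SpaceTime m → ℝ≥0∞) y =
        (((Finset.range J).filter fun j => y ∈ W j).card : ℝ≥0∞) := by
      simp [indicator_apply, Finset.sum_boole]
    rw [e1]
    by_cases hyI : y ∈ I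
    · obtain ⟨F, hF, hFx⟩ := (halt y J).exists_finset hΩ (hσ J) (c := c) (r := r)
        (fun l => (hr l).2)
        (fun x hx hx' hxS => mem_iUnion.1 (hcov ⟨hxS, hI y hyI x hx hx'⟩)) le_rfl
      rw [← hF]
      calc (F.card : ℝ≥0∞) = ∑ l ∈ F, (cube (proj (c l)) (r l)).indicator 1 y := by
            rw [Finset.card_eq_sum_ones, Nat.cast_sum]
            refine Finset.sum_congr rfl fun l hl => ?_
            obtain ⟨x, -, hx⟩ := hFx l hl
            have : y ∈ cube (proj (c l)) (r l) := by
              have := (mem_cube_succ.1 hx).1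
              rwa [proj_emb] at this
            simp [this]
        _ ≤ _ := ENNReal.sum_le_tsum F
    · rw [Finset.filter_false_of_mem fun j _ hj => hyI (hWI j hj)]
      simp
  calc ∑ j ∈ Finset.range J, volume (W j)
      = ∫⁻ y, ∑ j ∈ Finset.range J, (W j).indicator (1 : SpaceTime m → ℝ≥0∞) y := by
        rw [lintegral_finsetSum _
          fun j _ => measurable_one.indicator (hW j).measurableSet]
        simp [lintegral_indicator_one (hW _).measurableSet]
    _ ≤ ∫⁻ y, ∑' l, (cube (proj (c l)) (r l)).indicator (1 : SpaceTime m → ℝ≥0∞) y :=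
        lintegral_mono hpt
    _ = ∑' l, volume (cube (proj (c l)) (r l)) := by
        rw [lintegral_tsum fun l =>
          (measurable_one.indicator (isOpen_cube _ _).measurableSet).aemeasurable]
        simp [lintegral_indicator_one (isOpen_cube _ _).measurableSet]
    _ = ENNReal.ofReal (2 ^ (m + 1)) * ∑' l, ENNReal.ofReal (r l ^ (m + 2)) := by
        rw [← ENNReal.tsum_mul_left]
        refine tsum_congr fun l => ?_
        rw [volume_cube _ (hr l).1, ENNReal.ofReal_mul (by positivity)]
    _ ≤ _ := by
        rw [ENNReal.ofReal_mul (by positivity)]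
        gcongr

/-! ### A Chebyshev type estimate -/

lemma lintegral_volume_inter_cube {m : ℕ} {W : Set (SpaceTime m)} (hW : MeasurableSet W)
    {R : ℝ} (hR : 0 ≤ R) :
    ∫⁻ y, volume (W ∩ cube y R) = ENNReal.ofReal (2 ^ (m + 1) * R ^ (m + 2)) * volume W := by
  set A : Set (SpaceTime m × SpaceTime m) := {p | p.2 ∈ cube p.1 R} ∩ Prod.snd ⁻¹' W with hA
  have hAm : MeasurableSet A :=
    (isOpen_setOf_mem_cube R).measurableSet.inter (measurable_snd hW)
  have h1 : ((volume : Measure (SpaceTime m)).prod volume) A = ∫⁻ y, volume (W ∩ cube y R) := by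
    rw [Measure.prod_apply hAm]
    refine lintegral_congr fun y => ?_
    congr 1; ext x; simp [hA, and_comm]
  have h2 : ((volume : Measure (SpaceTime m)).prod volume) A =
      ENNReal.ofReal (2 ^ (m + 1) * R ^ (m + 2)) * volume W := by
    rw [Measure.prod_apply_symm hAm]
    have : ∀ x, volume ((fun y => (y, x)) ⁻¹' A) =
        W.indicator (fun _ => ENNReal.ofReal (2 ^ (m + 1) * R ^ (m + 2))) x := by
      intro x
      by_cases hx : x ∈ W
      · rw [indicator_of_mem hx, ← volume_cube x hR]
        congr 1; ext y
        simp only [hA, mem_preimage, mem_inter_iff, mem_ofPred_eq, hx, and_true]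
        exact mem_cube_comm
      · rw [indicator_of_notMem hx]
        convert! measure_empty (μ := volume)
        ext y; simp [hA, hx]
    simp_rw [this]
    rw [lintegral_indicator_const hW]
  rw [← h1, h2]

/-- Markov's inequality for the sum over `j` of the normalised densities of `W j` in `cube y (2 * s
j)`: the sum is at least `N` on `E`, and by Fubini each term has integral a constant times `volume
(W j)`. -/
lemma mul_volume_le_of_exists_finset {m : ℕ} {W : ℕ → Set (SpaceTime m)} (hW : ∀ j, IsOpen (W j))
    {s : ℕ → ℝ} (hs : ∀ j, 0 < s j) {κ : ℝ} (hκ : 0 < κ) {N : ℕ} {E : Set (SpaceTime m)}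
    (hE : ∀ y ∈ E, ∃ F : Finset ℕ, N ≤ F.card ∧
      ∀ j ∈ F, ENNReal.ofReal (κ * s j ^ (m + 2)) ≤ volume (W j ∩ cube y (2 * s j))) :
    N * volume E ≤ ENNReal.ofReal (2 ^ (m + 1) * 2 ^ (m + 2) / κ) * ∑' j, volume (W j) := by
  let φ : ℕ → SpaceTime m → ℝ≥0∞ := fun j y =>
    ENNReal.ofReal ((κ * s j ^ (m + 2))⁻¹) * volume (W j ∩ cube y (2 * s j))
  have hκs : ∀ j, 0 < κ * s j ^ (m + 2) := fun j => mul_pos hκ (pow_pos (hs j) _)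
  have hmeas0 : ∀ j, Measurable fun y => volume (W j ∩ cube y (2 * s j)) := by
    intro j
    have hAm : MeasurableSet ({p : SpaceTime m × SpaceTime m | p.2 ∈ cube p.1 (2 * s j)} ∩
        Prod.snd ⁻¹' (W j)) :=
      (isOpen_setOf_mem_cube _).measurableSet.inter (measurable_snd (hW j).measurableSet)
    convert! measurable_measure_prodMk_left (ν := (volume : Measure (SpaceTime m))) hAm using 2
    next y => congr 1; ext x; simp [and_comm]
  have hmeas : ∀ j, Measurable (φ j) := fun j => (hmeas0 j).const_mul _
  have hsub : E ⊆ {y | (N : ℝ≥0∞) ≤ ∑' j, φ j y} := by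
    intro y hy
    obtain ⟨F, hN, hF⟩ := hE y hy
    calc (N : ℝ≥0∞) ≤ F.card := by exact_mod_cast hN
      _ = ∑ j ∈ F, 1 := by simp
      _ ≤ ∑ j ∈ F, φ j y := by
          refine Finset.sum_le_sum fun j hj => ?_
          calc (1 : ℝ≥0∞) = ENNReal.ofReal ((κ * s j ^ (m + 2))⁻¹) *
                ENNReal.ofReal (κ * s j ^ (m + 2)) := by
                rw [← ENNReal.ofReal_mul (inv_nonneg.2 (hκs j).le),
                  inv_mul_cancel₀ (hκs j).ne', ENNReal.ofReal_one]
            _ ≤ _ := by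
                show _ ≤ ENNReal.ofReal ((κ * s j ^ (m + 2))⁻¹) * volume (W j ∩ cube y (2 * s j))
                gcongr
                exact hF j hj
      _ ≤ _ := ENNReal.sum_le_tsum F
  calc N * volume E ≤ N * volume {y | (N : ℝ≥0∞) ≤ ∑' j, φ j y} := by gcongr
    _ ≤ ∫⁻ y, ∑' j, φ j y := mul_meas_ge_le_lintegral (Measurable.tsum hmeas) _
    _ = ∑' j, ∫⁻ y, φ j y := lintegral_tsum fun j => (hmeas j).aemeasurable
    _ = _ := by
        rw [← ENNReal.tsum_mul_left]
        refine tsum_congr fun j => ?_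
        show ∫⁻ y, ENNReal.ofReal ((κ * s j ^ (m + 2))⁻¹) * volume (W j ∩ cube y (2 * s j)) = _
        have hsj := hs j
        rw [lintegral_const_mul _ (hmeas0 j), lintegral_volume_inter_cube (hW j).measurableSet
          (by positivity), ← mul_assoc, ← ENNReal.ofReal_mul (inv_nonneg.2 (hκs j).le)]
        congr 2
        rw [mul_pow]; field_simp

/-! ### Growth of the number of alternations -/

/-- The exterior half of the corkscrew condition, at all scales. -/
def ExteriorCorkscrew {n : ℕ} (Ω : Set (SpaceTime n)) (γ : ℝ) : Prop :=
  ∀ P ∈ frontier Ω, ∀ r : ℝ, 0 < r →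
    ∃ P' : SpaceTime n, cube P' (γ * r) ⊆ cube P r ∧ cube P' (γ * r) ⊆ (closure Ω)ᶜ

lemma mem_cube_of_pdist_le {n : ℕ} {y z x : SpaceTime n} {s : ℝ} (hs : 0 < s)
    (h : pdist y z ≤ s) (hx : x ∈ cube z s) : x ∈ cube y (2 * s) := by
  have h0 := norm_nonneg (y.1 - z.1)
  have h0' := Real.sqrt_nonneg |y.2 - z.2|
  unfold pdist at h
  refine ⟨fun i => ?_, ?_⟩
  · have h1 := abs_coord_le_norm (y.1 - z.1) i
    simp only [PiLp.sub_apply] at h1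
    have h2 := abs_sub_le (x.1 i) (z.1 i) (y.1 i)
    rw [abs_sub_comm (z.1 i)] at h2
    linarith [hx.1 i]
  · have h1 : |y.2 - z.2| ≤ s ^ 2 := (Real.sqrt_le_left hs.le).1 (by linarith)
    have h2 := abs_sub_le x.2 z.2 y.2
    rw [abs_sub_comm z.2] at h2
    nlinarith [hx.2]

/-- The exterior corkscrew cube of `w` lies above the interior cube at height `h`, and over its
projection the two form a new pair on top of the old ones. -/
lemma exists_shadow {m : ℕ} {Ω : Set (SpaceTime (m + 1))} {γ : ℝ} (hγ : 0 < γ) (hγ1 : γ ≤ 1)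
    (hcork : ExteriorCorkscrew Ω γ) {y : SpaceTime m} {f h₀ h top s : ℝ} {w : SpaceTime (m + 1)}
    (hw : w ∈ frontier Ω) (hs : 0 < s) (hρ : pdist y (proj w) ≤ s)
    (hline : ∀ x, f < x → x < top → emb y x ∈ Ω) (hwin : cube (emb y h) (2 * s) ⊆ Ω)
    (hf : h₀ < f) (hfh : f < h) (hhw : h < lastCoord w - s) (hwt : lastCoord w + s ≤ top) :
    ∃ y' : SpaceTime m, cube y' (γ * s) ⊆ cube y (2 * s) ∧
      ∀ x ∈ cube y' (γ * s / 2), ∀ p, Alternates Ω h₀ (4 * s) x p top →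
        Alternates Ω h₀ (γ * s / 4) x (p + 1) top := by
  obtain ⟨P', hP'w, hP'e⟩ := hcork w hw s hs
  have hγs : 0 < γ * s := mul_pos hγ hs
  have hP'1 := mem_cube_succ.1 (hP'w (self_mem_cube P' hγs))
  have hsub : cube (proj P') (γ * s) ⊆ cube y (2 * s) := by
    intro x hx
    have h1 : emb x (lastCoord P') ∈ cube P' (γ * s) := by
      rw [mem_cube_succ]; simpa using ⟨hx, hγs⟩
    have h2 := (mem_cube_succ.1 (hP'w h1)).1
    rw [proj_emb] at h2
    exact mem_cube_of_pdist_le hs hρ h2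
  refine ⟨proj P', hsub, fun x hx p hp => ?_⟩
  have hxP : cube x (γ * s / 4) ⊆ cube (proj P') (γ * s) :=
    cube_subset_cube hx (by linarith) (by nlinarith)
  have hxy : x ∈ cube y (2 * s) := hsub (cube_mono _ (by linarith) (by linarith) hx)
  have hγs2 : γ * s / 4 ≤ 2 * s := by nlinarith
  have hp1 : Alternates Ω h₀ (2 * s) y p top :=
    hp.mono (by linarith) (cube_subset_cube (mem_cube_comm.1 hxy) (by linarith) (by nlinarith))
  -- The old pairs lie below `h`: their cubes are wide enough to reach the line over `y`, which
  -- stays in `Ω` between `f` and `top`, so no exterior centre can be above `f`.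
  have hp2 : Alternates Ω h₀ (2 * s) y p h := by
    cases p with
    | zero => exact hf.trans hfh
    | succ p =>
      obtain ⟨g, e, hge, het, hg, he, H⟩ := hp1
      refine ⟨g, e, hge, ?_, hg, he, H⟩
      by_contra! hle
      exact he (self_mem_cube _ (by linarith)) (subset_closure (hline e (by linarith) het))
  have h3 := abs_lt.1 hP'1.2
  refine ⟨h, lastCoord P', by linarith, by linarith,
    (cube_emb_subset hγs2 (hxP.trans hsub) h).trans hwin, ?_,
    hp2.mono hγs2 (hxP.trans hsub)⟩
  have := cube_emb_subset (s' := γ * s / 4) (s := γ * s) (by linarith) hxP (lastCoord P')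
  rw [emb_proj_lastCoord] at this
  exact this.trans hP'e

/-- Test cubes of radius `2 * s` are centred on the line at `k` heights spaced by `6 * s`. One that
misses the boundary lies in `Ω`, since its centre does; if none does, the boundary points chosen in
them are `6 * s - 4 * s` apart in height. -/
lemma exists_window_or_stack {m : ℕ} {Ω : Set (SpaceTime (m + 1))} (hΩ : IsOpen Ω)
    {y : SpaceTime m} {f ℓ s : ℝ} (hs : 0 < s) (k : ℕ)
    (hline : ∀ x, f < x → x < ℓ → emb y x ∈ Ω) (hk : 6 * s * (k + 1) ≤ ℓ - f) :
    (∃ h, f < h ∧ h < ℓ - s ∧ cube (emb y h) (2 * s) ⊆ Ω) ∨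
      ∃ q : Fin k → SpaceTime (m + 1),
        (∀ i, q i ∈ frontier Ω ∧ proj (q i) ∈ cube y (2 * s) ∧
          f < lastCoord (q i) ∧ lastCoord (q i) < ℓ) ∧
        ∀ i j, i ≠ j → 2 * s ≤ |lastCoord (q i) - lastCoord (q j)| := by
  let η : Fin k → ℝ := fun i => f + 6 * s * ((i : ℕ) + 1)
  have hη : ∀ i, f + 6 * s ≤ η i ∧ η i ≤ ℓ - 6 * s := by
    intro i
    have h1 : ((i : ℕ) : ℝ) + 1 ≤ k := by exact_mod_cast i.2
    have h2 : (0 : ℝ) ≤ (i : ℕ) := Nat.cast_nonneg _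
    constructor <;> simp only [η] <;> nlinarith
  by_cases hwin : ∃ i, ∀ x ∈ cube (emb y (η i)) (2 * s), x ∉ frontier Ω
  · obtain ⟨i, hi⟩ := hwin
    obtain ⟨h1, h2⟩ := hη i
    refine Or.inl ⟨η i, by linarith, by linarith, subset_of_disjoint_frontier hΩ
      (convex_cube _ _).isPreconnected ⟨emb y (η i), self_mem_cube _ (by linarith),
        hline _ (by linarith) (by linarith)⟩ hi⟩
  · push Not at hwin
    choose q hq hqS using hwin
    have hq' := fun i => mem_cube_succ.1 (hq i)
    simp only [proj_emb, lastCoord_emb] at hq'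
    refine Or.inr ⟨q, fun i => ⟨hqS i, (hq' i).1, ?_, ?_⟩, fun i j hij => ?_⟩
    · linarith [abs_lt.1 (hq' i).2, hη i]
    · linarith [abs_lt.1 (hq' i).2, hη i]
    · have h1 := abs_lt.1 (hq' i).2
      have h2 := abs_lt.1 (hq' j).2
      have hne : (i : ℕ) ≠ (j : ℕ) := fun h => hij (Fin.ext h)
      rcases lt_or_gt_of_ne hne with hlt | hlt
      · have h3 : ((i : ℕ) : ℝ) + 1 ≤ (j : ℕ) := by exact_mod_cast hlt
        have h4 : η i + 6 * s ≤ η j := by simp only [η]; nlinarith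
        rw [le_abs]; right; linarith
      · have h3 : ((j : ℕ) : ℝ) + 1 ≤ (i : ℕ) := by exact_mod_cast hlt
        have h4 : η j + 6 * s ≤ η i := by simp only [η]; nlinarith
        rw [le_abs]; left; linarith

/-- The first scale not exceeding `A` is at least `l * A`, so it and the next `N - 1` scales are at
least `l ^ N * A`. -/
lemma exists_finset_scales {s₀ l A ρ : ℝ} (hs₀ : 0 < s₀) (hl : 0 < l) (hl1 : l < 1) (hA : 0 < A)
    (hAs : A ≤ s₀) (N : ℕ) (hρ : ρ ≤ l ^ N * A) :
    ∃ F : Finset ℕ, N ≤ F.card ∧ ∀ j ∈ F, ρ ≤ s₀ * l ^ j ∧ s₀ * l ^ j ≤ A := by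
  classical
  have hex : ∃ j, s₀ * l ^ j ≤ A := by
    obtain ⟨j, hj⟩ := exists_pow_lt_of_lt_one (div_pos hA hs₀) hl1
    exact ⟨j, by rw [lt_div_iff₀ hs₀] at hj; linarith⟩
  set i := Nat.find hex with hi
  have h1 : s₀ * l ^ i ≤ A := Nat.find_spec hex
  have h2 : l * A ≤ s₀ * l ^ i := by
    rcases Nat.eq_zero_or_pos i with h0 | h0
    · rw [h0, pow_zero]; nlinarith
    · obtain ⟨t, ht⟩ := Nat.exists_eq_succ_of_ne_zero h0.ne'
      have := Nat.find_min hex (m := t) (by omega)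
      push Not at this
      rw [ht, Nat.succ_eq_add_one, pow_succ]; nlinarith
  refine ⟨Finset.Ico i (i + N), by simp, fun j hj => ?_⟩
  rw [Finset.mem_Ico] at hj
  constructor
  · obtain ⟨N', rfl⟩ : ∃ N', N = N' + 1 := ⟨N - 1, by omega⟩
    have h3 : l ^ (i + N') ≤ l ^ j := pow_le_pow_of_le_one hl.le hl1.le (by omega)
    have h4 : 0 < l ^ N' := pow_pos hl _
    calc ρ ≤ l ^ (N' + 1) * A := hρ
      _ = l ^ N' * (l * A) := by ring
      _ ≤ l ^ N' * (s₀ * l ^ i) := by gcongr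
      _ = s₀ * l ^ (i + N') := by ring
      _ ≤ _ := by gcongr
  · refine le_trans ?_ h1
    gcongr ?_ * ?_
    exact pow_le_pow_of_le_one hl.le hl1.le hj.1

/-- The points over which the first boundary point, seen from above, lies in a steep shadow of
another boundary point, and which are not below a stack of boundary points, form a small set. -/
lemma volume_shadowed_le {m : ℕ} {Ω : Set (SpaceTime (m + 1))} (hΩ : IsOpen Ω) {C γ : ℝ}
    (hC : CubeCoverable (frontier Ω) C) (hγ : 0 < γ) (hγ1 : γ ≤ 1)
    (hcork : ExteriorCorkscrew Ω γ) {P : SpaceTime (m + 1)} (hP : P ∈ frontier Ω) {R : ℝ}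
    (hR : 0 < R) {h₀ top : ℝ} (htop : h₀ < top) {k N : ℕ} {s₀ : ℝ} (hs₀ : 0 < s₀)
    (hs₀' : top - h₀ ≤ 6 * (k + 1) * s₀) {I : Set (SpaceTime m)}
    (hI : ∀ y ∈ I, ∀ x, h₀ - s₀ < x → x < top + s₀ → emb y x ∈ cube P R) {b : ℝ}
    (hb : 6 * (k + 1) / (γ / 16) ^ N ≤ b) {E : Set (SpaceTime m)}
    (hEI : ∀ y ∈ E, cube y (3 * s₀) ⊆ I)
    (hE : ∀ y ∈ E, ∃ f, h₀ < f ∧ (∀ x, f < x → x < top → emb y x ∈ Ω) ∧ ∃ w ∈ frontier Ω,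
      lastCoord w + s₀ ≤ top ∧ 0 < pdist y (proj w) ∧ b * pdist y (proj w) ≤ lastCoord w - f) :
    N * volume (E \ stacked (frontier Ω) P R s₀ k) ≤
      ENNReal.ofReal (2 ^ (m + 1) * 2 ^ (m + 2) / (2 ^ (m + 1) * (γ / 2) ^ (m + 2)) *
        (2 ^ (m + 1) * (C * R ^ (m + 2)))) := by
  have hK : (0 : ℝ) < 6 * (k + 1) := by positivity
  -- The ratio `γ / 16` makes `4 * s (j + 1) = γ * s j / 4`: the output scale of `exists_shadow` is
  -- the input scale of the next step.
  let s : ℕ → ℝ := fun j => s₀ * (γ / 16) ^ j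
  have hs : ∀ j, 0 < s j := fun j => by positivity
  have hss₀ : ∀ j, s j ≤ s₀ := fun j =>
    mul_le_of_le_one_right hs₀.le (pow_le_one₀ (by positivity) (by linarith))
  let good : ℕ → SpaceTime m → Prop := fun j y' => cube y' (γ * s j) ⊆ I ∧
    ∀ x ∈ cube y' (γ * s j / 2), ∀ p, Alternates Ω h₀ (4 * s j) x p top →
        Alternates Ω h₀ (γ * s j / 4) x (p + 1) top
  let W : ℕ → Set (SpaceTime m) := fun j => ⋃ y', ⋃ (_ : good j y'), cube y' (γ * s j / 2)
  have hW : ∀ j, IsOpen (W j) := fun j =>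
    isOpen_iUnion fun y' => isOpen_iUnion fun _ => isOpen_cube _ _
  have hmemW : ∀ j x, x ∈ W j ↔ ∃ y', good j y' ∧ x ∈ cube y' (γ * s j / 2) := by
    intro j x; simp [W]
  have hWI : ∀ j, W j ⊆ I := by
    intro j x hx
    obtain ⟨y', hy', hx⟩ := (hmemW j x).1 hx
    have := mul_pos hγ (hs j)
    exact hy'.1 (cube_mono _ (by linarith) (by linarith) hx)
  have htot : ∑' j, volume (W j) ≤ ENNReal.ofReal (2 ^ (m + 1) * (C * R ^ (m + 2))) := by
    refine tsum_volume_le_of_alternates hΩ hC hP hR htop (I := I)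
      (fun y hy x hx hx' => hI y hy x (by linarith) (by linarith)) hW hWI (σ := fun j => 4 * s j)
      (fun j => by have := hs j; positivity) ?_ ?_
    · refine antitone_nat_of_succ_le fun j => ?_
      have h1 : s (j + 1) = s j * (γ / 16) := by simp only [s]; ring
      have := hs j
      rw [h1]; nlinarith
    · intro j x hx p hp
      obtain ⟨y', hy', hx⟩ := (hmemW j x).1 hx
      have h1 : 4 * s (j + 1) = γ * s j / 4 := by simp only [s]; ring
      rw [h1]
      exact hy'.2 x hx p hp
  have hκ : (0 : ℝ) < 2 ^ (m + 1) * (γ / 2) ^ (m + 2) := by positivity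
  refine (mul_volume_le_of_exists_finset hW hs hκ (N := N) ?_).trans ?_
  · rintro y ⟨hyE, hyst⟩
    obtain ⟨f, hf, hline, w, hw, hwt, hρ, hbρ⟩ := hE y hyE
    set ρ := pdist y (proj w) with hρdef
    have hbpos : 0 < b := lt_of_lt_of_le (by positivity) hb
    have hr : 0 < lastCoord w - f := lt_of_lt_of_le (by positivity) hbρ
    -- The upper limit leaves room for `k` test cubes between `f` and `w`; the size of `b` makes `N`
    -- scales fit between `ρ` and it.
    obtain ⟨F, hF, hFs⟩ := exists_finset_scales hs₀ (l := γ / 16) (by positivity) (by linarith)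
      (A := (lastCoord w - f) / (6 * (k + 1))) (by positivity)
      (by rw [div_le_iff₀ hK]; linarith) N (ρ := ρ) (by
        rw [div_le_iff₀ (by positivity)] at hb
        rw [mul_div_assoc', le_div_iff₀ hK]
        calc ρ * (6 * (k + 1)) ≤ ρ * (b * (γ / 16) ^ N) := by gcongr
          _ = (γ / 16) ^ N * (b * ρ) := by ring
          _ ≤ _ := by gcongr)
    refine ⟨F, hF, fun j hj => ?_⟩
    obtain ⟨h1, h2⟩ := hFs j hj
    change ρ ≤ s j at h1
    change s j ≤ _ at h2
    rw [le_div_iff₀ hK] at h2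
    have hsj := hs j
    have hsj₀ := hss₀ j
    have hγs := mul_pos hγ hsj
    rcases exists_window_or_stack hΩ hsj k (ℓ := lastCoord w)
      (fun x hx hx' => hline x hx (by linarith)) (by linarith) with ⟨h, hfh, hhw, hwin⟩ | ⟨q, hq, hsep⟩
    · obtain ⟨y', hy', hgrow⟩ := exists_shadow hγ hγ1 hcork hw hsj h1 hline hwin hf hfh hhw
        (by linarith)
      have hgood : good j y' := ⟨hy'.trans ((cube_mono y (by linarith) (by linarith)).trans
        (hEI y hyE)), hgrow⟩
      have hle : cube y' (γ * s j / 2) ⊆ W j ∩ cube y (2 * s j) := fun x hx =>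
        ⟨(hmemW j x).2 ⟨y', hgood, hx⟩, hy' (cube_mono _ (by linarith) (by linarith) hx)⟩
      refine le_trans (le_of_eq ?_) (measure_mono hle)
      rw [volume_cube _ (by linarith)]
      congr 1
      rw [show γ * s j / 2 = γ / 2 * s j by ring, mul_pow (γ / 2) (s j)]
      ring
    · refine absurd ⟨s j, hsj, hsj₀, q, fun i => ⟨(hq i).1, (hq i).2.1, fun x hx => ?_⟩, hsep⟩ hyst
      obtain ⟨hx1, hx2⟩ := mem_cube_succ.1 hx
      have h3 : proj x ∈ I := hEI y hyE
        (mem_cube_trans (hq i).2.1 hx1 (by linarith) (by nlinarith))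
      have h4 := abs_lt.1 hx2
      have h5 := (hq i).2.2
      have h6 := hI _ h3 (lastCoord x) (by linarith) (by linarith)
      rwa [emb_proj_lastCoord] at h6
  · rw [ENNReal.ofReal_mul (by positivity)]
    gcongr

/-! ### Lip(1,1/2) graphs -/

lemma continuous_pdist {n : ℕ} (P : SpaceTime n) : Continuous fun Q => pdist P Q := by
  unfold pdist; fun_prop

lemma IsLipHalf.continuous {m : ℕ} {ψ : SpaceTime m → ℝ} {b : ℝ} (h : IsLipHalf ψ b) :
    Continuous ψ := by
  refine continuous_iff_continuousAt.2 fun p => ?_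
  rw [ContinuousAt, tendsto_iff_dist_tendsto_zero]
  have h0 : Filter.Tendsto (fun q => b * pdist p q) (nhds p) (nhds 0) := by
    have := ((continuous_pdist p).const_mul b).tendsto p
    simpa [pdist] using this
  refine squeeze_zero (fun _ => dist_nonneg) (fun q => ?_) h0
  rw [dist_comm, Real.dist_eq]
  exact h p q

/-- The smallest Lip(1,1/2) function with constant `b` lying above the points of `T`, and above
the level `h₀`. -/
lemma exists_isLipHalf_majorant {m : ℕ} (T : Set (SpaceTime (m + 1))) {h₀ h₁ b : ℝ}
    (hT : ∀ q ∈ T, lastCoord q ≤ h₁) (h01 : h₀ ≤ h₁) (hb : 0 ≤ b) :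
    ∃ ψ : SpaceTime m → ℝ, IsLipHalf ψ b ∧ (∀ y, h₀ ≤ ψ y ∧ ψ y ≤ h₁) ∧
      (∀ q ∈ T, lastCoord q ≤ ψ (proj q)) ∧
      ∀ y v, h₀ ≤ v → v < ψ y → ∃ q ∈ T, v < lastCoord q - b * pdist y (proj q) := by
  let V : SpaceTime m → Set ℝ := fun y =>
    insert h₀ ((fun q => lastCoord q - b * pdist y (proj q)) '' T)
  have hV : ∀ y, ∀ v ∈ V y, v ≤ h₁ := by
    rintro y v (rfl | ⟨q, hq, rfl⟩)
    · exact h01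
    · have := mul_nonneg hb (pdist_nonneg y (proj q))
      have := hT q hq
      simp only; linarith
  have hbdd : ∀ y, BddAbove (V y) := fun y => ⟨h₁, hV y⟩
  have hne : ∀ y, (V y).Nonempty := fun y => ⟨h₀, mem_insert _ _⟩
  have hmem : ∀ y, ∀ q ∈ T, lastCoord q - b * pdist y (proj q) ≤ sSup (V y) := fun y q hq =>
    le_csSup (hbdd y) (mem_insert_of_mem _ ⟨q, hq, rfl⟩)
  have hlow : ∀ y, h₀ ≤ sSup (V y) := fun y => le_csSup (hbdd y) (mem_insert _ _)
  have hle : ∀ p q, sSup (V p) ≤ sSup (V q) + b * pdist p q := by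
    intro p q
    have hnn := mul_nonneg hb (pdist_nonneg p q)
    refine csSup_le (hne p) ?_
    rintro v (rfl | ⟨x, hx, rfl⟩)
    · linarith [hlow q]
    · have h1 := hmem q x hx
      have h2 := pdist_triangle q p (proj x)
      rw [pdist_comm q p] at h2
      have h3 := mul_le_mul_of_nonneg_left h2 hb
      simp only; linarith
  refine ⟨fun y => sSup (V y), fun p q => ?_, fun y => ⟨hlow y, csSup_le (hne y) (hV y)⟩,
    fun q hq => ?_, fun y v hv hlt => ?_⟩
  · rw [abs_le]
    have h1 := hle p q
    have h2 := hle q p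
    rw [pdist_comm q p] at h2
    constructor <;> linarith
  · simpa [pdist] using hmem (proj q) q hq
  · obtain ⟨x, hx, hlt'⟩ := exists_lt_of_lt_csSup (hne y) hlt
    rcases hx with rfl | ⟨q, hq, rfl⟩
    · exact absurd hv (not_le.2 hlt')
    · exact ⟨q, hq, hlt'⟩

lemma isOpen_graphRegion {m : ℕ} {ψ : SpaceTime m → ℝ} (hψ : Continuous ψ) (z : SpaceTime m)
    (l t : ℝ) : IsOpen (graphRegion ψ z l t) := by
  have : graphRegion ψ z l t = proj ⁻¹' cube z l ∩ {P | ψ (proj P) < lastCoord P} ∩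
      {P | lastCoord P < t} := by
    ext P; simp [graphRegion, and_assoc]
  rw [this]
  refine (((isOpen_cube z l).preimage continuous_proj).inter
    (isOpen_lt (hψ.comp continuous_proj) continuous_lastCoord)).inter
    (isOpen_lt continuous_lastCoord continuous_const)

/-- Every point can be moved vertically to the level `u`, where the slice is a full convex cube. -/
lemma isConnected_graphRegion {m : ℕ} {ψ : SpaceTime m → ℝ} {z : SpaceTime m} {l t u : ℝ}
    (hl : 0 < l) (hut : u < t) (hψ : ∀ y ∈ cube z l, ψ y < u) :
    IsConnected (graphRegion ψ z l t) := by
  have hmem : ∀ y ∈ cube z l, emb y u ∈ graphRegion ψ z l t := fun y hy => by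
    simpa [graphRegion] using ⟨hy, hψ y hy, hut⟩
  refine ⟨⟨_, hmem z (self_mem_cube z hl)⟩,
    isPreconnected_of_forall (emb z u) fun Q hQ => ?_⟩
  refine ⟨(fun h => emb (proj Q) h) '' uIcc (lastCoord Q) u ∪ (fun y => emb y u) '' cube z l,
    ?_, Or.inr (mem_image_of_mem _ (self_mem_cube z hl)),
    Or.inl ⟨lastCoord Q, left_mem_uIcc, by simp⟩, ?_⟩
  · rintro _ (⟨h, hh, rfl⟩ | ⟨y, hy, rfl⟩)
    · obtain ⟨h1, h2, h3⟩ := hQ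
      have h4 := hψ _ h1
      have h5 : ψ (proj Q) < h := lt_of_lt_of_le (lt_min h2 h4) hh.1
      have h6 : h < t := lt_of_le_of_lt hh.2 (max_lt h3 hut)
      simpa [graphRegion] using ⟨h1, h5, h6⟩
    · exact hmem y hy
  · refine IsPreconnected.union (emb (proj Q) u) (mem_image_of_mem _ right_mem_uIcc)
      (mem_image_of_mem _ hQ.1) ?_ ?_
    · exact isPreconnected_uIcc.image _
        (continuous_emb.comp (continuous_const.prodMk continuous_id)).continuousOn
    · exact (convex_cube z l).isPreconnected.image _
        (continuous_emb.comp (continuous_id.prodMk continuous_const)).continuousOn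

lemma emb_mem_frontier_graphRegion {m : ℕ} {ψ : SpaceTime m → ℝ} (hψ : Continuous ψ)
    {z y : SpaceTime m} {l t : ℝ} (hy : y ∈ cube z l) (ht : ψ y < t) :
    emb y (ψ y) ∈ frontier (graphRegion ψ z l t) := by
  rw [frontier, (isOpen_graphRegion hψ z l t).interior_eq]
  refine ⟨?_, fun h => by simpa using h.2.1⟩
  refine map_mem_closure (f := fun h => emb y h) (s := Ioo (ψ y) t)
    (continuous_emb.comp (continuous_const.prodMk continuous_id)) ?_ ?_
  · rw [closure_Ioo ht.ne]; exact left_mem_Icc.2 ht.le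
  · intro h hh
    simpa [graphRegion] using ⟨hy, hh.1, hh.2⟩

/-- The highest boundary point on a vertical segment. -/
lemma exists_top_crossing {m : ℕ} {Ω : Set (SpaceTime (m + 1))} (hΩ : IsOpen Ω) {y : SpaceTime m}
    {g e : ℝ} (hge : g ≤ e) (hg : emb y g ∉ Ω) (he : emb y e ∈ Ω) :
    ∃ f ∈ Icc g e, emb y f ∈ frontier Ω ∧ ∀ x, f < x → x ≤ e → emb y x ∈ Ω := by
  have hc : Continuous fun h => emb y h :=
    continuous_emb.comp (continuous_const.prodMk continuous_id)
  obtain ⟨x₀, hx₀, hx₀S⟩ := exists_crossing hΩ he hg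
  rw [uIcc_comm, uIcc_of_le hge] at hx₀
  have hcomp : IsCompact (Icc g e ∩ (fun h => emb y h) ⁻¹' frontier Ω) :=
    isCompact_Icc.inter_right (isClosed_frontier.preimage hc)
  obtain ⟨f, ⟨hf, hfS⟩, hmax⟩ := hcomp.exists_isGreatest ⟨x₀, hx₀, hx₀S⟩
  refine ⟨f, hf, hfS, fun x hfx hxe => ?_⟩
  have hsub : (fun h => emb y h) '' Icc x e ⊆ Ω := by
    refine subset_of_disjoint_frontier hΩ (isPreconnected_Icc.image _ hc.continuousOn)
      ⟨_, mem_image_of_mem _ (right_mem_Icc.2 hxe), he⟩ ?_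
    rintro _ ⟨u, hu, rfl⟩ huS
    have : u ≤ f := hmax ⟨⟨by linarith [hf.1, hu.1], hu.2⟩, huS⟩
    linarith [hu.1]
  exact hsub (mem_image_of_mem _ (left_mem_Icc.2 hxe))

lemma le_ofReal_of_natCast_mul_le {k : ℕ} {X : ℝ≥0∞} {A B : ℝ} (hk : 0 < k)
    (h : k * X ≤ ENNReal.ofReal A) (hAB : A ≤ k * B) : X ≤ ENNReal.ofReal B := by
  have hk' : (0 : ℝ) < k := by exact_mod_cast hk
  have h1 : (k : ℝ≥0∞) * X ≤ k * ENNReal.ofReal B := by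
    refine h.trans ((ENNReal.ofReal_le_ofReal hAB).trans_eq ?_)
    rw [ENNReal.ofReal_mul hk'.le, ENNReal.ofReal_natCast]
  exact (ENNReal.mul_le_mul_iff_right (by exact_mod_cast hk.ne') (ENNReal.natCast_ne_top k)).1 h1

set_option maxHeartbeats 1000000 in
/-- Existence of big pieces of Lip(1,1/2) graphs in coordinates in which the exterior cube lies
below the given point. -/
theorem exists_graphRegion (m : ℕ) {γ C a θ η Λ : ℝ} (hγ : 0 < γ) (hγ1 : γ ≤ 1)
    (ha0 : 0 < a) (hθ : 0 < θ) (hη : 0 < η) (hηθ : η ≤ θ / 8) (hΛ : 0 < Λ) :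
    ∃ b ε : ℝ, 0 ≤ b ∧ 0 < ε ∧ ∀ Ω : Set (SpaceTime (m + 1)), IsOpen Ω →
      CubeCoverable (frontier Ω) C → CubeContent (frontier Ω) a → ExteriorCorkscrew Ω γ →
      ∀ d : ℝ, 0 < d → ∀ Q E : SpaceTime (m + 1), cube Q (θ * d) ⊆ Ω →
        cube E (η * d) ⊆ (closure Ω)ᶜ → (proj Q).1 = (proj E).1 →
        |Q.2 - E.2| ≤ (θ * d / 4) ^ 2 → lastCoord E < lastCoord Q →
        lastCoord Q - lastCoord E ≤ Λ * d →
        ∃ (ψ : SpaceTime m → ℝ), ∃ P ∈ frontier Ω, proj P = proj E ∧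
          lastCoord E < lastCoord P ∧ lastCoord P < lastCoord Q ∧ IsLipHalf ψ b ∧
          IsOpen (graphRegion ψ (proj E) (θ / 2 * d) (lastCoord Q + θ / 2 * d)) ∧
          IsConnected (graphRegion ψ (proj E) (θ / 2 * d) (lastCoord Q + θ / 2 * d)) ∧
          cube Q (θ / 4 * d) ⊆ graphRegion ψ (proj E) (θ / 2 * d) (lastCoord Q + θ / 2 * d) ∧
          graphRegion ψ (proj E) (θ / 2 * d) (lastCoord Q + θ / 2 * d) ⊆ Ω ∧
          (∀ X ∈ graphRegion ψ (proj E) (θ / 2 * d) (lastCoord Q + θ / 2 * d),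
            lastCoord E < lastCoord X) ∧
          ENNReal.ofReal (ε * d ^ (m + 2)) ≤ volume (proj '' (frontier Ω ∩
            frontier (graphRegion ψ (proj E) (θ / 2 * d) (lastCoord Q + θ / 2 * d))) ∩
              cube (proj E) (θ / 2 * d)) := by
  set v : ℝ := 2 ^ (m + 1) * η ^ (m + 2) with hv
  have hv0 : 0 < v := by positivity
  set S₀ : ℝ := 2 ^ (m + 1) * 18 ^ (m + 2) / a * (C * (Λ + θ) ^ (m + 2)) with hS₀
  set T₀ : ℝ := 2 ^ (m + 1) * 2 ^ (m + 2) / (2 ^ (m + 1) * (γ / 2) ^ (m + 2)) *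
        (2 ^ (m + 1) * (C * (Λ + θ) ^ (m + 2))) with hT₀
  -- Here `v * d ^ (m + 2)` is the volume of the shadow of the exterior cube. The choices of `k` and
  -- `N` let stacks and steep shadows each take at most a quarter of it; `k > 4 * Λ / θ` also keeps
  -- the largest scale `s₀` below `θ * d / 24`.
  obtain ⟨k, hk⟩ := exists_nat_gt (max (4 * S₀ / v) (max (4 * Λ / θ) 0))
  obtain ⟨N, hN⟩ := exists_nat_gt (max (4 * T₀ / v) 0)
  have hk1 : 4 * S₀ / v < k := (le_max_left _ _).trans_lt hk
  have hk2 : 4 * Λ / θ < k := (le_max_left _ _).trans_lt ((le_max_right _ _).trans_lt hk)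
  have hk0 : (0 : ℝ) < k := (le_max_right _ _).trans_lt ((le_max_right _ _).trans_lt hk)
  have hN1 : 4 * T₀ / v < N := (le_max_left _ _).trans_lt hN
  have hN0 : (0 : ℝ) < N := (le_max_right _ _).trans_lt hN
  rw [div_lt_iff₀ hv0] at hk1 hN1
  rw [div_lt_iff₀ hθ] at hk2
  set b : ℝ := 6 * (k + 1) / (γ / 16) ^ N with hbdef
  refine ⟨b, v / 2, by positivity, by positivity, ?_⟩
  intro Ω hΩ hC ha hcork d hd Q E hQ hE hxy htime hlast hΛd
  set y₂ := proj E with hy₂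
  set h₂ := lastCoord E with hh₂
  set ĥ := lastCoord Q with hĥ
  have hθd : 0 < θ * d := mul_pos hθ hd
  have hηd : 0 < η * d := mul_pos hη hd
  have hηθd : η * d ≤ θ * d / 8 := by nlinarith
  set I := cube y₂ (θ / 2 * d) with hI
  have hIQ : ∀ y ∈ I, y ∈ cube (proj Q) (θ * d) := by
    rintro y ⟨hy1, hy2⟩
    refine ⟨fun i => ?_, ?_⟩
    · rw [hxy]; linarith [hy1 i]
    · have h1 := abs_sub_le y.2 E.2 Q.2
      rw [abs_sub_comm E.2] at h1
      change |y.2 - E.2| < _ at hy2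
      change |y.2 - Q.2| < _
      nlinarith
  have hQmem : ∀ y ∈ I, ∀ x, |x - ĥ| < θ * d → emb y x ∈ Ω := fun y hy x hx => hQ (by
    rw [mem_cube_succ]; simpa using ⟨hIQ y hy, hx⟩)
  have hI1I : cube y₂ (η * d) ⊆ I := cube_mono _ hηd.le (by linarith)
  have hEmem : ∀ y ∈ cube y₂ (η * d), emb y h₂ ∈ (closure Ω)ᶜ := fun y hy => hE (by
    rw [mem_cube_succ, proj_emb, lastCoord_emb]
    exact ⟨hy, by rw [hh₂, sub_self, abs_zero]; exact hηd⟩)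
  have hEmem' : ∀ y ∈ cube y₂ (η * d), emb y h₂ ∉ Ω := fun y hy h =>
    hEmem y hy (subset_closure h)
  have hy₂I : y₂ ∈ cube y₂ (η * d) := self_mem_cube _ hηd
  have hgap : h₂ ≤ ĥ - θ * d := by
    by_contra! hlt
    refine hEmem' y₂ hy₂I (hQmem y₂ (hI1I hy₂I) h₂ ?_)
    rw [abs_lt]; constructor <;> linarith
  set T : Set (SpaceTime (m + 1)) :=
    {q | q ∈ frontier Ω ∧ proj q ∈ I ∧ h₂ ≤ lastCoord q ∧ lastCoord q ≤ ĥ} with hT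
  have hTtop : ∀ q ∈ T, lastCoord q ≤ ĥ - θ * d := by
    rintro q ⟨hqS, hqI, hq1, hq2⟩
    by_contra! hlt
    refine notMem_of_mem_frontier hΩ hqS ?_
    rw [← emb_proj_lastCoord q]
    exact hQmem _ hqI _ (by rw [abs_lt]; constructor <;> linarith)
  obtain ⟨ψ, hψL, hψb, hψT, hψex⟩ := exists_isLipHalf_majorant T hTtop hgap
    (show 0 ≤ b by positivity)
  have hcross : ∀ y ∈ cube y₂ (η * d), ∃ f, h₂ < f ∧ f ≤ ĥ ∧ emb y f ∈ frontier Ω ∧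
      ∀ x, f < x → x ≤ ĥ → emb y x ∈ Ω := by
    intro y hy
    obtain ⟨f, hf, hfS, hfΩ⟩ := exists_top_crossing hΩ hlast.le (hEmem' y hy)
      (hQmem y (hI1I hy) ĥ (by simpa using hθd))
    refine ⟨f, lt_of_le_of_ne hf.1 ?_, hf.2, hfS, hfΩ⟩
    rintro rfl
    exact hEmem y hy hfS.1
  obtain ⟨f₂, hf₂, hf₂', hf₂S, -⟩ := hcross y₂ hy₂I
  have hf₂T : emb y₂ f₂ ∈ T := ⟨hf₂S, by simpa using hI1I hy₂I, by simpa using hf₂.le,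
    by simpa using hf₂'⟩
  have hf₂top := hTtop _ hf₂T
  rw [lastCoord_emb] at hf₂top
  set G := graphRegion ψ y₂ (θ / 2 * d) (ĥ + θ / 2 * d) with hG
  have hGo : IsOpen G := isOpen_graphRegion hψL.continuous _ _ _
  have hGc : IsConnected G := isConnected_graphRegion (u := ĥ) (by linarith) (by linarith)
    fun y _ => by linarith [(hψb y).2]
  have hQG : cube Q (θ / 4 * d) ⊆ G := by
    intro X hX
    obtain ⟨hX1, hX2⟩ := mem_cube_succ.1 hX
    have hX3 := abs_lt.1 hX2
    refine ⟨⟨fun i => ?_, ?_⟩, ?_, ?_⟩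
    · rw [← hxy]; linarith [hX1.1 i]
    · have h1 := abs_sub_le X.2 Q.2 E.2
      have h2 : |X.2 - Q.2| < (θ / 4 * d) ^ 2 := hX1.2
      change |X.2 - E.2| < _
      nlinarith
    · linarith [(hψb (proj X)).2]
    · linarith
  have hGΩ : G ⊆ Ω := by
    -- The region is connected and contains `Q`. Up to the height of `Q` its points lie above `ψ`,
    -- which majorises the boundary points there; higher up they are in the cube around `Q`.
    refine subset_of_disjoint_frontier hΩ hGc.isPreconnected
      ⟨Q, hQG (self_mem_cube Q (by positivity)), hQ (self_mem_cube Q hθd)⟩ ?_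
    rintro X ⟨hX1, hX2, hX3⟩ hXS
    have h1 := (hψb (proj X)).1
    rcases le_or_gt (lastCoord X) ĥ with hle | hgt
    · exact absurd (hψT X ⟨hXS, hX1, by linarith, hle⟩) (not_le.2 hX2)
    · refine notMem_of_mem_frontier hΩ hXS ?_
      rw [← emb_proj_lastCoord X]
      exact hQmem _ hX1 _ (by rw [abs_lt]; constructor <;> linarith)
  refine ⟨ψ, emb y₂ f₂, hf₂S, proj_emb _ _, by simpa using hf₂, by rw [lastCoord_emb]; linarith,
    hψL, hGo, hGc, hQG, hGΩ, fun X hX => (hψb _).1.trans_lt hX.2.1, ?_⟩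
  -- the set where the graph does not touch the boundary
  set B : Set (SpaceTime m) := {y | y ∈ cube y₂ (η * d) ∧ emb y (ψ y) ∉ frontier Ω} with hB
  set s₀ : ℝ := Λ * d / (6 * (k + 1)) with hs₀
  have hs₀0 : 0 < s₀ := by positivity
  have hs₀θ : 24 * s₀ ≤ θ * d := by
    rw [hs₀, mul_div_assoc', div_le_iff₀ (by positivity)]
    nlinarith
  have hs₀Λ : ĥ - h₂ ≤ 6 * (k + 1) * s₀ := by
    rw [hs₀, mul_div_cancel₀ _ (by positivity)]; exact hΛd
  clear_value s₀
  set R : ℝ := (Λ + θ) * d with hR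
  have hR0 : 0 < R := by positivity
  have hIR : ∀ y ∈ I, ∀ x, h₂ - s₀ < x → x < ĥ + s₀ → emb y x ∈ cube (emb y₂ f₂) R := by
    intro y hy x hx1 hx2
    rw [mem_cube_succ]
    simp only [proj_emb, lastCoord_emb]
    refine ⟨cube_mono _ (by positivity) (by nlinarith) hy, ?_⟩
    rw [abs_lt]; constructor <;> nlinarith
  have hshadow := volume_shadowed_le hΩ hC hγ hγ1 hcork hf₂S hR0 hlast (k := k) (N := N) hs₀0
    hs₀Λ hIR (b := b) le_rfl (E := B)
    (fun y hy => (cube_subset_cube hy.1 (u := θ / 2 * d) (by linarith) (by nlinarith)))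
    (by
      rintro y ⟨hy, hyψ⟩
      obtain ⟨f, hf1, hf2, hfS, hfΩ⟩ := hcross y hy
      have hfT : emb y f ∈ T := ⟨hfS, by simpa using hI1I hy, by simpa using hf1.le,
        by simpa using hf2⟩
      have hfψ : f ≤ ψ y := by simpa using hψT _ hfT
      have hfψ' : f < ψ y := lt_of_le_of_ne hfψ fun h => hyψ (h ▸ hfS)
      obtain ⟨w, hw, hwlt⟩ := hψex y f hf1.le hfψ'
      refine ⟨f, hf1, fun x hx hx' => hfΩ x hx hx'.le, w, hw.1, ?_, ?_, by linarith⟩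
      · linarith [hTtop w hw]
      -- At distance zero `w` would be a boundary point over `y` higher than `f`, the highest one.
      · refine lt_of_le_of_ne (pdist_nonneg _ _) fun h0 => ?_
        have hyw := eq_of_pdist_eq_zero h0.symm
        rw [← h0, mul_zero, sub_zero] at hwlt
        refine notMem_of_mem_frontier hΩ hw.1 ?_
        rw [← emb_proj_lastCoord w, ← hyw]
        exact hfΩ _ hwlt hw.2.2.2)
  have hstack := volume_stacked_le hC ha ha0 hf₂S hR0 s₀ k
  have hdp : 0 < d ^ (m + 2) := by positivity
  have hRp : R ^ (m + 2) = (Λ + θ) ^ (m + 2) * d ^ (m + 2) := by rw [hR, mul_pow]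
  have hst' : volume (stacked (frontier Ω) (emb y₂ f₂) R s₀ k) ≤
      ENNReal.ofReal (v / 4 * d ^ (m + 2)) := by
    refine le_ofReal_of_natCast_mul_le (by exact_mod_cast hk0) hstack ?_
    calc _ = S₀ * d ^ (m + 2) := by rw [hRp, hS₀]; ring
      _ ≤ (k * v / 4) * d ^ (m + 2) := by gcongr; linarith
      _ = _ := by ring
  have hsh' : volume (B \ stacked (frontier Ω) (emb y₂ f₂) R s₀ k) ≤
      ENNReal.ofReal (v / 4 * d ^ (m + 2)) := by
    refine le_ofReal_of_natCast_mul_le (by exact_mod_cast hN0) hshadow ?_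
    calc _ = T₀ * d ^ (m + 2) := by rw [hRp, hT₀]; ring
      _ ≤ (N * v / 4) * d ^ (m + 2) := by gcongr; linarith
      _ = _ := by ring
  have hBv : volume B ≤ ENNReal.ofReal (v / 2 * d ^ (m + 2)) := by
    calc volume B ≤ volume (stacked (frontier Ω) (emb y₂ f₂) R s₀ k ∪
          (B \ stacked (frontier Ω) (emb y₂ f₂) R s₀ k)) := measure_mono (by simp)
      _ ≤ _ := measure_union_le _ _
      _ ≤ ENNReal.ofReal (v / 4 * d ^ (m + 2)) + ENNReal.ofReal (v / 4 * d ^ (m + 2)) :=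
          add_le_add hst' hsh'
      _ = _ := by rw [← ENNReal.ofReal_add (by positivity) (by positivity)]; congr 1; ring
  have hcontact : cube y₂ (η * d) \ B ⊆ proj '' (frontier Ω ∩ frontier G) ∩ I := by
    rintro y ⟨hy, hyB⟩
    have hyS : emb y (ψ y) ∈ frontier Ω := by
      by_contra h; exact hyB ⟨hy, h⟩
    exact ⟨⟨_, ⟨hyS, emb_mem_frontier_graphRegion hψL.continuous (hI1I hy)
      (by linarith [(hψb y).2])⟩, proj_emb _ _⟩, hI1I hy⟩
  refine le_trans ?_ (measure_mono hcontact)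
  have htotal : ENNReal.ofReal (v / 2 * d ^ (m + 2)) + ENNReal.ofReal (v / 2 * d ^ (m + 2)) ≤
      volume (cube y₂ (η * d) \ B) + ENNReal.ofReal (v / 2 * d ^ (m + 2)) := by
    calc _ = volume (cube y₂ (η * d)) := by
          rw [← ENNReal.ofReal_add (by positivity) (by positivity), volume_cube _ hηd.le, hv]
          congr 1; rw [mul_pow]; ring
      _ ≤ volume ((cube y₂ (η * d) \ B) ∪ B) := measure_mono (by simp)
      _ ≤ _ := measure_union_le _ _
      _ ≤ _ := by gcongr
  exact (ENNReal.add_le_add_iff_right ENNReal.ofReal_ne_top).1 htotal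

/-! ### Orthogonal changes of the space variables -/

/-- An orthogonal change of the space variables, as a homeomorphism. -/
noncomputable def rotHomeo {n : ℕ}
    (ϱ : EuclideanSpace ℝ (Fin n) ≃ₗᵢ[ℝ] EuclideanSpace ℝ (Fin n)) :
    SpaceTime n ≃ₜ SpaceTime n :=
  ϱ.toHomeomorph.prodCongr (Homeomorph.refl ℝ)

@[simp] lemma rot_symm_rot {n : ℕ}
    (ϱ : EuclideanSpace ℝ (Fin n) ≃ₗᵢ[ℝ] EuclideanSpace ℝ (Fin n)) (P : SpaceTime n) :
    rot ϱ.symm (rot ϱ P) = P := by simp [rot]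

@[simp] lemma rot_rot_symm {n : ℕ}
    (ϱ : EuclideanSpace ℝ (Fin n) ≃ₗᵢ[ℝ] EuclideanSpace ℝ (Fin n)) (P : SpaceTime n) :
    rot ϱ (rot ϱ.symm P) = P := by simp [rot]

lemma preimage_rot_frontier {n : ℕ}
    (ϱ : EuclideanSpace ℝ (Fin n) ≃ₗᵢ[ℝ] EuclideanSpace ℝ (Fin n)) (U : Set (SpaceTime n)) :
    frontier (rot ϱ ⁻¹' U) = rot ϱ ⁻¹' frontier U :=
  ((rotHomeo ϱ).preimage_frontier U).symm

lemma preimage_rot_closure {n : ℕ}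
    (ϱ : EuclideanSpace ℝ (Fin n) ≃ₗᵢ[ℝ] EuclideanSpace ℝ (Fin n)) (U : Set (SpaceTime n)) :
    closure (rot ϱ ⁻¹' U) = rot ϱ ⁻¹' closure U :=
  ((rotHomeo ϱ).preimage_closure U).symm

/-- The Euclidean norm of the space increment is at most `n * r` and is preserved by `ϱ`; this loss
of `n + 1` is the source of the constants in the rotated properties below. -/
lemma rot_mem_cube {n : ℕ} (ϱ : EuclideanSpace ℝ (Fin n) ≃ₗᵢ[ℝ] EuclideanSpace ℝ (Fin n))
    {P Q : SpaceTime n} {r : ℝ} (hr : 0 ≤ r) (h : Q ∈ cube P r) :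
    rot ϱ Q ∈ cube (rot ϱ P) ((n + 1) * r) := by
  have hr0 : 0 < r := by
    have h1 : 0 < r ^ 2 := (abs_nonneg _).trans_lt h.2
    exact lt_of_le_of_ne hr fun h0 => by simp [← h0] at h1
  have hn : (0 : ℝ) ≤ n := Nat.cast_nonneg n
  have h1 : ‖Q.1 - P.1‖ ≤ n * r := norm_le_of_forall_abs_le _ fun i => by simpa using (h.1 i).le
  refine ⟨fun i => ?_, ?_⟩
  · have h2 := abs_coord_le_norm (ϱ (Q.1 - P.1)) i
    rw [ϱ.norm_map, map_sub] at h2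
    simp only [PiLp.sub_apply] at h2
    simp only [rot]
    linarith
  · have h2 : r ^ 2 ≤ ((n + 1) * r) ^ 2 := by
      have : r ≤ (n + 1) * r := by nlinarith
      gcongr
    exact h.2.trans_le h2

lemma CubeCoverable.rot {n : ℕ} (ϱ : EuclideanSpace ℝ (Fin n) ≃ₗᵢ[ℝ] EuclideanSpace ℝ (Fin n))
    {S : Set (SpaceTime n)} {C : ℝ} (h : CubeCoverable S C) :
    CubeCoverable (rot ϱ.symm ⁻¹' S) (((n : ℝ) + 1) ^ (n + 1) * (C * ((n : ℝ) + 1) ^ (n + 1))) := by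
  intro P hP R hR δ hδ
  have hκ : (0 : ℝ) < (n : ℝ) + 1 := by positivity
  obtain ⟨c, r, hr, hcov, hsum⟩ := h _ hP ((n + 1) * R) (by positivity) (δ / (n + 1))
    (by positivity)
  refine ⟨fun l => Parabolic.rot ϱ (c l), fun l => (n + 1) * r l, fun l => ⟨?_, ?_⟩, ?_, ?_⟩
  · have := (hr l).1; positivity
  · have := (hr l).2
    rw [le_div_iff₀ hκ] at this
    linarith
  · rintro x ⟨hxS, hx⟩
    obtain ⟨l, hl⟩ := mem_iUnion.1 (hcov ⟨hxS, rot_mem_cube ϱ.symm hR.le hx⟩)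
    refine mem_iUnion.2 ⟨l, ?_⟩
    simpa using rot_mem_cube ϱ (hr l).1 hl
  · calc ∑' l, ENNReal.ofReal (((n + 1) * r l) ^ (n + 1))
        = ENNReal.ofReal (((n : ℝ) + 1) ^ (n + 1)) * ∑' l, ENNReal.ofReal (r l ^ (n + 1)) := by
          rw [← ENNReal.tsum_mul_left]
          refine tsum_congr fun l => ?_
          rw [mul_pow, ENNReal.ofReal_mul (by positivity)]
      _ ≤ ENNReal.ofReal (((n : ℝ) + 1) ^ (n + 1)) *
          ENNReal.ofReal (C * ((n + 1) * R) ^ (n + 1)) := by gcongr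
      _ = _ := by
          rw [← ENNReal.ofReal_mul (by positivity), mul_pow]
          congr 1; ring

lemma CubeContent.rot {n : ℕ} (ϱ : EuclideanSpace ℝ (Fin n) ≃ₗᵢ[ℝ] EuclideanSpace ℝ (Fin n))
    {S : Set (SpaceTime n)} {a : ℝ} (h : CubeContent S a) :
    CubeContent (rot ϱ.symm ⁻¹' S)
      ((((n : ℝ) + 1) ^ (n + 1))⁻¹ * (a / ((n : ℝ) + 1) ^ (n + 1))) := by
  intro P hP R hR c r hr hcov
  have hκ : (0 : ℝ) < (n : ℝ) + 1 := by positivity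
  have key := h _ hP (R / (n + 1)) (by positivity) (fun l => Parabolic.rot ϱ.symm (c l))
    (fun l => (n + 1) * r l) (fun l => by have := hr l; positivity) ?_
  · have e1 : ∑' l, ENNReal.ofReal (((n + 1) * r l) ^ (n + 1)) =
        ENNReal.ofReal (((n : ℝ) + 1) ^ (n + 1)) * ∑' l, ENNReal.ofReal (r l ^ (n + 1)) := by
      rw [← ENNReal.tsum_mul_left]
      refine tsum_congr fun l => ?_
      rw [mul_pow, ENNReal.ofReal_mul (by positivity)]
    rw [e1] at key
    have hpos : 0 < ((n : ℝ) + 1) ^ (n + 1) := by positivity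
    rw [mul_assoc, ENNReal.ofReal_mul (by positivity), ENNReal.ofReal_inv_of_pos hpos]
    refine (ENNReal.inv_mul_le_iff (by simpa using hpos) ENNReal.ofReal_ne_top).2 ?_
    refine le_trans (le_of_eq ?_) key
    rw [div_pow]; congr 1; ring
  · rintro x ⟨hxS, hx⟩
    have h1 := rot_mem_cube ϱ (by positivity) hx
    rw [rot_rot_symm, mul_div_cancel₀ _ hκ.ne'] at h1
    obtain ⟨l, hl⟩ := mem_iUnion.1 (hcov ⟨by simpa using hxS, h1⟩)
    refine mem_iUnion.2 ⟨l, ?_⟩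
    simpa using rot_mem_cube ϱ.symm (hr l) hl

lemma ExteriorCorkscrew.rot {n : ℕ}
    (ϱ : EuclideanSpace ℝ (Fin n) ≃ₗᵢ[ℝ] EuclideanSpace ℝ (Fin n))
    {Ω : Set (SpaceTime n)} {γ : ℝ} (hγ : 0 < γ) (h : ExteriorCorkscrew Ω γ) :
    ExteriorCorkscrew (rot ϱ.symm ⁻¹' Ω) (γ / ((n : ℝ) + 1) ^ 2) := by
  intro P hP r hr
  have hκ : (0 : ℝ) < (n : ℝ) + 1 := by positivity
  rw [preimage_rot_frontier] at hP
  obtain ⟨P', h1, h2⟩ := h _ hP (r / (n + 1)) (by positivity)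
  have hmem : ∀ x ∈ cube (Parabolic.rot ϱ P') (γ / ((n : ℝ) + 1) ^ 2 * r),
      Parabolic.rot ϱ.symm x ∈ cube P' (γ * (r / (n + 1))) := by
    intro x hx
    have h3 := rot_mem_cube ϱ.symm (by positivity) hx
    rw [rot_symm_rot] at h3
    convert! h3 using 1
    field_simp
  refine ⟨Parabolic.rot ϱ P', fun x hx => ?_, fun x hx => ?_⟩
  · have h4 := rot_mem_cube ϱ (by positivity) (h1 (hmem x hx))
    rwa [rot_rot_symm, rot_rot_symm, mul_div_cancel₀ _ hκ.ne'] at h4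
  · rw [preimage_rot_closure]
    exact h2 (hmem x hx)

/-- Every non-zero vector can be rotated into the direction of the last coordinate axis. -/
lemma exists_rotation_to_last {m : ℕ} (u : EuclideanSpace ℝ (Fin (m + 1))) :
    ∃ ϱ : EuclideanSpace ℝ (Fin (m + 1)) ≃ₗᵢ[ℝ] EuclideanSpace ℝ (Fin (m + 1)),
      ϱ u = ‖u‖ • EuclideanSpace.single (Fin.last m) (1 : ℝ) := by
  -- A reflection exchanges two vectors of equal norm.
  refine ⟨_, Submodule.reflection_sub (v := u) ?_⟩
  simp [norm_smul]

/-! ### The distance to the boundary -/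

lemma pdistSet_le {n : ℕ} {P Q : SpaceTime n} {S : Set (SpaceTime n)} (hQ : Q ∈ S) :
    pdistSet P S ≤ pdist P Q :=
  ciInf_le (f := fun Q : S => pdist P (Q : SpaceTime n))
    ⟨0, by rintro _ ⟨Q, rfl⟩; exact pdist_nonneg _ _⟩ ⟨Q, hQ⟩

lemma exists_pdist_lt {n : ℕ} {P : SpaceTime n} {S : Set (SpaceTime n)} (hS : S.Nonempty) {t : ℝ}
    (ht : pdistSet P S < t) : ∃ Q ∈ S, pdist P Q < t := by
  have : Nonempty S := hS.to_subtype
  obtain ⟨⟨Q, hQ⟩, h⟩ := exists_lt_of_ciInf_lt ht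
  exact ⟨Q, hQ, h⟩

lemma pdistSet_frontier_pos {n : ℕ} {Ω : Set (SpaceTime n)} (hΩ : IsOpen Ω)
    (hS : (frontier Ω).Nonempty) {P : SpaceTime n} (hP : P ∈ Ω) : 0 < pdistSet P (frontier Ω) := by
  obtain ⟨s, hs, hsub⟩ := exists_cube_subset hΩ hP
  have : Nonempty (frontier Ω) := hS.to_subtype
  refine hs.trans_le (le_ciInf fun Q => ?_)
  by_contra! hlt
  exact notMem_of_mem_frontier hΩ Q.2 (hsub (mem_cube_of_pdist_lt hlt))

lemma cube_subset_of_pdistSet {n : ℕ} {Ω : Set (SpaceTime n)} (hΩ : IsOpen Ω) {P : SpaceTime n}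
    (hP : P ∈ Ω) (hd : 0 < pdistSet P (frontier Ω)) :
    cube P (pdistSet P (frontier Ω) / (n + 1)) ⊆ Ω := by
  have hκ : (0 : ℝ) < (n : ℝ) + 1 := by positivity
  refine subset_of_disjoint_frontier hΩ (convex_cube _ _).isPreconnected
    ⟨P, self_mem_cube P (by positivity), hP⟩ fun x hx hxS => ?_
  have h1 := cube_subset_ball_pdist (by positivity) hx
  rw [mul_div_cancel₀ _ hκ.ne'] at h1
  exact absurd (pdistSet_le hxS) (not_le.2 h1)

/-- Near every point of `Ω`, and almost at the same time, there is a large exterior cube. -/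
lemma exists_exterior_cube (n : ℕ) {M M' γ θ : ℝ} (hM : 0 < M) (hM' : 0 < M')
    (hθ : 0 < θ) :
    ∃ Λ : ℝ, 0 < Λ ∧ ∀ Ω : Set (SpaceTime n), (frontier Ω).Nonempty →
      (∀ P ∈ frontier Ω, ∀ r : ℝ, 0 < r →
        surf (surfCube (frontier Ω) P r) ≤ ENNReal.ofReal (M * r ^ (n + 1))) →
      (∀ P ∈ frontier Ω, ∀ r : ℝ, 0 < r → ENNReal.ofReal (M'⁻¹ * r ^ (n + 1)) ≤
        surf (surfCube (frontier Ω) P r ∩ {Q | P.2 ≤ Q.2})) →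
      (∀ P ∈ frontier Ω, ∀ r : ℝ, 0 < r → ENNReal.ofReal (M'⁻¹ * r ^ (n + 1)) ≤
        surf (surfCube (frontier Ω) P r ∩ {Q | Q.2 ≤ P.2})) →
      ExteriorCorkscrew Ω γ → 0 < γ → ∀ P : SpaceTime n, 0 < pdistSet P (frontier Ω) →
      ∃ E : SpaceTime n, cube E (γ * (θ * pdistSet P (frontier Ω) / 8)) ⊆ (closure Ω)ᶜ ∧
        |P.2 - E.2| ≤ (θ * pdistSet P (frontier Ω) / 4) ^ 2 ∧
        ‖P.1 - E.1‖ ≤ Λ * pdistSet P (frontier Ω) := by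
  obtain ⟨k, hk⟩ := exists_nat_gt (M * M' * 2 ^ (n + 1))
  have hk0 : (0 : ℝ) < k := lt_trans (by positivity) hk
  -- The near point `P₀` differs in time from `P` by at most `4 * d ^ 2`, and `N` steps of radius `θ
  -- * d / 8` each gain `(θ * d / 8) ^ 2 / k ^ 2`.
  obtain ⟨N, hN⟩ := exists_nat_gt (256 * k ^ 2 / θ ^ 2)
  refine ⟨2 + n * ((N + 1) * θ / 8), by positivity, ?_⟩
  intro Ω hne hup hf hb hcork hγ P hd
  set d := pdistSet P (frontier Ω) with hdef
  have hR : 0 < θ * d / 8 := by positivity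
  obtain ⟨P₀, hP₀, hlt⟩ := exists_pdist_lt hne (t := 2 * d) (by linarith)
  have hP₀x : ‖P.1 - P₀.1‖ ≤ 2 * d := by
    unfold pdist at hlt; linarith [Real.sqrt_nonneg |P.2 - P₀.2|]
  have hP₀t : |P.2 - P₀.2| ≤ (2 * d) ^ 2 := by
    unfold pdist at hlt
    exact (Real.sqrt_le_left (by linarith)).1 (by linarith [norm_nonneg (P.1 - P₀.1)])
  obtain ⟨Q, hQ, hQt, hQx⟩ := exists_time_near hM hM' hup hf hb hk hP₀ (τ := P.2) hR (N := N) (by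
    refine hP₀t.trans ?_
    rw [div_lt_iff₀ (by positivity)] at hN
    have e : (N : ℝ) * ((θ * d / 8) ^ 2 / k ^ 2) = N * θ ^ 2 * (d ^ 2 / (64 * k ^ 2)) := by
      field_simp; norm_num
    rw [e]
    calc (2 * d) ^ 2 = 256 * k ^ 2 * (d ^ 2 / (64 * k ^ 2)) := by field_simp; norm_num
      _ ≤ _ := by gcongr)
  obtain ⟨E, hE1, hE2⟩ := hcork Q hQ _ hR
  have hEQ := hE1 (self_mem_cube E (by positivity))
  refine ⟨E, hE2, ?_, ?_⟩
  · have h1 := abs_sub_le P.2 Q.2 E.2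
    rw [abs_sub_comm P.2 Q.2, abs_sub_comm Q.2 E.2] at h1
    nlinarith [hEQ.2]
  · have h1 : ‖P₀.1 - E.1‖ ≤ n * ((N + 1) * (θ * d / 8)) := by
      refine norm_le_of_forall_abs_le _ fun i => ?_
      have h2 := abs_sub_le (P₀.1 i) (Q.1 i) (E.1 i)
      rw [abs_sub_comm (P₀.1 i) (Q.1 i), abs_sub_comm (Q.1 i) (E.1 i)] at h2
      simp only [PiLp.sub_apply]
      linarith [hQx i, hEQ.1 i]
    calc ‖P.1 - E.1‖ ≤ ‖P.1 - P₀.1‖ + ‖P₀.1 - E.1‖ := norm_sub_le_norm_sub_add_norm_sub _ _ _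
      _ ≤ 2 * d + n * ((N + 1) * (θ * d / 8)) := add_le_add hP₀x h1
      _ = _ := by ring

end Parabolic

/-! ### Choice of constants and coordinates -/

set_option maxHeartbeats 1000000 in
theorem mainTheorem7 (m : ℕ) (M γ₀ M' : ℝ) (hM : 1 ≤ M) (hγ₀ : 0 < γ₀) (hγ₁ : γ₀ < 1)
    (hM' : 1 ≤ M') :
    ∃ ε b C c A : ℝ, 0 < ε ∧ 0 ≤ b ∧ 1 ≤ C ∧ 0 < c ∧ 0 < A ∧
      ∀ Ω : Set (SpaceTime (m + 1)), IsOpen Ω →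
        Parabolic.IsADR (frontier Ω) M →
        Parabolic.IsTimeSymmetricADR (frontier Ω) M' →
        Parabolic.Corkscrew Ω γ₀ →
        Parabolic.InteriorBigPieces Ω ε b C c A := by
  open Parabolic in
  have hM0 : 0 < M := by linarith
  have hM'0 : 0 < M' := by linarith
  set κ : ℝ := ((m + 1 : ℕ) : ℝ) + 1 with hκ
  have hκ1 : 1 ≤ κ := by
    have : (0 : ℝ) ≤ ((m + 1 : ℕ) : ℝ) := Nat.cast_nonneg _
    linarith
  have hκ0 : 0 < κ := by linarith
  -- One factor `1 / κ` makes the cube around the given point lie in its parabolic ball of radius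
  -- `d`; the other pays for the rotation. The factor `1 / κ` in `η` below likewise pays for
  -- rotating the exterior cube.
  set θ : ℝ := 1 / κ ^ 2 with hθdef
  have hθ : 0 < θ := by positivity
  have hθκ : κ * θ = 1 / κ := by rw [hθdef]; field_simp
  have hθκ' : κ * θ ≤ 1 := by rw [hθκ, div_le_one hκ0]; exact hκ1
  set η : ℝ := γ₀ * θ / (8 * κ) with hηdef
  have hη : 0 < η := by positivity
  have hηθ : η ≤ θ / 8 := by
    rw [hηdef, div_le_div_iff₀ (by positivity) (by norm_num)]
    have : γ₀ * θ ≤ θ * κ := by nlinarith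
    linarith
  obtain ⟨Λ, hΛ, hext⟩ := exists_exterior_cube (m + 1) (γ := γ₀) hM0 hM'0 hθ
  have hγκ : γ₀ / κ ^ 2 ≤ 1 := by
    rw [div_le_one (by positivity)]
    nlinarith
  obtain ⟨b, ε, hb, hε, hcore⟩ := exists_graphRegion m (γ := γ₀ / κ ^ 2)
    (C := κ ^ (m + 2) * ((2 ^ (m + 2) * (2 * M)) * κ ^ (m + 2)))
    (a := (κ ^ (m + 2))⁻¹ * (((M * 2 ^ (m + 2))⁻¹ * M⁻¹) / κ ^ (m + 2)))
    (θ := θ) (η := η) (Λ := Λ) (by positivity) hγκ (by positivity) hθ hη hηθ hΛ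
  -- Rotated back, the domain and the boundary point lie in the cube of radius `κ * (Λ + θ) * d`
  -- around the given point; the extra `1` makes room for the surface cube of radius `d / 2`.
  refine ⟨min ε (θ / (4 * κ)), b, κ * (Λ + θ) + 1, θ / 2, θ / 2, by positivity, hb,
    by nlinarith [mul_pos hκ0 (add_pos hΛ hθ)], by positivity, by positivity, ?_⟩
  intro Ω hΩ hADR hTS hcork
  have hT1 := hTS.1.1
  have hT0 := hTS.2.1
  have hslab := slab_eq_univ hT0 hT1
  have hup : ∀ P ∈ frontier Ω, ∀ r : ℝ, 0 < r →
      surf (surfCube (frontier Ω) P r) ≤ ENNReal.ofReal (M * r ^ (m + 1 + 1)) := fun P hP r hr =>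
    (hADR.2 P hP (hslab ▸ mem_univ P) r hr (ofReal_lt_pdiam hT1 r)).2
  have hlow : ∀ P ∈ frontier Ω, ∀ r : ℝ, 0 < r →
      ENNReal.ofReal (M⁻¹ * r ^ (m + 1 + 1)) ≤ surf (surfCube (frontier Ω) P r) :=
    fun P hP r hr => (hADR.2 P hP (hslab ▸ mem_univ P) r hr (ofReal_lt_pdiam hT1 r)).1
  have hfw : ∀ P ∈ frontier Ω, ∀ r : ℝ, 0 < r → ENNReal.ofReal (M'⁻¹ * r ^ (m + 1 + 1)) ≤
      surf (surfCube (frontier Ω) P r ∩ {Q | P.2 ≤ Q.2}) := fun P hP r hr =>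
    hTS.1.2 P hP (hT0 ▸ EReal.bot_lt_coe _) r hr (ofReal_lt_pdiam hT1 r)
  have hbw : ∀ P ∈ frontier Ω, ∀ r : ℝ, 0 < r → ENNReal.ofReal (M'⁻¹ * r ^ (m + 1 + 1)) ≤
      surf (surfCube (frontier Ω) P r ∩ {Q | Q.2 ≤ P.2}) := fun P hP r hr =>
    hTS.2.2 P hP (hT1 ▸ EReal.coe_lt_top _) r hr (ofReal_lt_pdiam hT1 r)
  have hcov := cubeCoverable_of_surf_le hM0 hup
  have hcont := cubeContent_of_isADR hM0 hup hlow
  have hecork : ExteriorCorkscrew Ω γ₀ := by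
    intro P hP r hr
    obtain ⟨ρ, -, P₂, hρ, -, -, h2, -, h4⟩ :=
      hcork P hP (hslab ▸ mem_univ P) r hr (ofReal_lt_pdiam hT1 r)
    rw [hslab, inter_univ] at h4
    have := cube_mono P₂ (by positivity) hρ
    exact ⟨P₂, this.trans h2, this.trans h4⟩
  have hne : (frontier Ω).Nonempty := by
    obtain ⟨P, hP, -⟩ := T1_exists hT1 0
    exact ⟨P, hP⟩
  intro Q hQ
  have hd := pdistSet_frontier_pos hΩ hne hQ
  have hQcube := cube_subset_of_pdistSet hΩ hQ hd
  obtain ⟨E, hE, hEt, hEx⟩ := hext Ω hne hup hfw hbw hecork hγ₀ Q hd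
  rw [← hκ] at hQcube
  set d := pdistSet Q (frontier Ω) with hddef
  -- With equal space coordinates `E` would lie in the cube around `Q` contained in `Ω`, as the two
  -- times nearly agree.
  have hu : Q.1 - E.1 ≠ 0 := by
    intro h0
    refine hE (self_mem_cube E (by positivity)) (subset_closure (hQcube ?_))
    have h1 : θ * d / 4 < d / κ := by
      have : κ * (θ * d / 4) < d := by nlinarith
      rw [lt_div_iff₀ hκ0]; linarith
    refine ⟨fun i => ?_, ?_⟩
    · rw [← sub_eq_zero.1 h0]; simp; positivity
    · rw [abs_sub_comm]
      refine hEt.trans_lt ?_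
      gcongr
  obtain ⟨ϱ, hϱ⟩ := exists_rotation_to_last (Q.1 - E.1)
  rw [map_sub] at hϱ
  have hcoord : ∀ i, (ϱ Q.1) i - (ϱ E.1) i =
      ‖Q.1 - E.1‖ * (EuclideanSpace.single (Fin.last m) (1 : ℝ)) i := fun i => by
    rw [← PiLp.sub_apply, hϱ]; simp
  have hrotmem : ∀ {X : SpaceTime (m + 1)} {Y : SpaceTime (m + 1)} {r : ℝ}, 0 ≤ r →
      rot ϱ X ∈ cube (rot ϱ Y) r → X ∈ cube Y (κ * r) := by
    intro X Y r hr h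
    have h1 := rot_mem_cube ϱ.symm hr h
    rwa [rot_symm_rot, rot_symm_rot] at h1
  have hQE : lastCoord (rot ϱ Q) - lastCoord (rot ϱ E) = ‖Q.1 - E.1‖ := by
    have := hcoord (Fin.last m)
    simpa [lastCoord, rot] using this
  have hQE0 : 0 < ‖Q.1 - E.1‖ := norm_pos_iff.2 hu
  have hxy : (proj (rot ϱ Q)).1 = (proj (rot ϱ E)).1 := by
    ext i
    have := hcoord i.castSucc
    simp only [PiLp.single_apply, (Fin.castSucc_lt_last i).ne, if_false, mul_zero] at this
    simpa [proj, rot] using sub_eq_zero.1 this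
  obtain ⟨ψ, P', hP', hPE, hEP, hPQ, hψ, hGo, hGc, hQG, hGΩ, hGlow, hvol⟩ :=
    hcore (rot ϱ.symm ⁻¹' Ω) (hΩ.preimage (rotHomeo ϱ.symm).continuous)
      (by rw [preimage_rot_frontier]; exact hcov.rot ϱ)
      (by rw [preimage_rot_frontier]; exact hcont.rot ϱ)
      (hecork.rot ϱ hγ₀) d hd (rot ϱ Q) (rot ϱ E)
      (fun X hX => by
        have h1 := rot_mem_cube ϱ.symm (by positivity) hX
        rw [rot_symm_rot, ← hκ, ← mul_assoc, hθκ, one_div_mul_eq_div] at h1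
        exact hQcube h1)
      (fun X hX => by
        have h1 := rot_mem_cube ϱ.symm (by positivity) hX
        rw [rot_symm_rot, ← hκ] at h1
        rw [preimage_rot_closure]
        refine hE ?_
        convert! h1 using 1
        rw [hηdef]; field_simp)
      hxy hEt (by linarith) (by rw [hQE]; exact hEx)
  set G := graphRegion ψ (proj (rot ϱ E)) (θ / 2 * d) (lastCoord (rot ϱ Q) + θ / 2 * d) with hG
  rw [preimage_rot_frontier] at hP' hvol
  set C : ℝ := κ * (Λ + θ) + 1 with hC
  -- all relevant points are close to `Q`
  have hnear : ∀ X : SpaceTime (m + 1), proj (rot ϱ X) ∈ cube (proj (rot ϱ E)) (θ / 2 * d) →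
      lastCoord (rot ϱ E) < lastCoord (rot ϱ X) →
      lastCoord (rot ϱ X) < lastCoord (rot ϱ Q) + θ / 2 * d →
      X ∈ cube Q (κ * ((Λ + θ) * d)) := by
    intro X h1 h2 h3
    refine hrotmem (by positivity) (mem_cube_succ.2 ⟨⟨fun i => ?_, ?_⟩, ?_⟩)
    · rw [hxy]
      refine (h1.1 i).trans_le ?_
      gcongr
      linarith
    · have h4 : |X.2 - E.2| < (θ / 2 * d) ^ 2 := h1.2
      have h5 := abs_sub_le X.2 E.2 Q.2
      rw [abs_sub_comm E.2] at h5
      change |X.2 - Q.2| < _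
      have h6 : (θ * d) ^ 2 ≤ ((Λ + θ) * d) ^ 2 := by gcongr; linarith
      have h7 : 0 < (θ * d) ^ 2 := by positivity
      linarith [show (θ / 2 * d) ^ 2 = (θ * d) ^ 2 / 4 by ring,
        show (θ * d / 4) ^ 2 = (θ * d) ^ 2 / 16 by ring]
    · have h4 : 0 < θ * d := by positivity
      rw [abs_lt]
      constructor <;> linarith [hQE, add_mul Λ θ d, mul_pos hΛ hd]
  have hCd : κ * ((Λ + θ) * d) + d = C * d := by rw [hC]; ring
  have hclose : 0 < κ * ((Λ + θ) * d) := by positivity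
  have hPQcube : rot ϱ.symm P' ∈ cube Q (κ * ((Λ + θ) * d)) := by
    refine hnear _ ?_ ?_ ?_ <;> rw [rot_rot_symm]
    · rw [hPE]; exact self_mem_cube _ (by positivity)
    · exact hEP
    · have : 0 < θ / 2 * d := by positivity
      linarith
  refine ⟨ψ, rot ϱ ⁻¹' G, ϱ, rot ϱ.symm P', hψ, hGo.preimage (rotHomeo ϱ).continuous,
    (rotHomeo ϱ).isConnected_preimage.2 hGc, ⟨fun X hX => ?_, fun X hX => ⟨?_, ?_⟩⟩,
    ⟨⟨hP', ?_⟩, fun X hX => ⟨hX.1, ?_⟩, ?_⟩, ?_⟩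
  · have hε' : min ε (θ / (4 * κ)) ≤ θ / (4 * κ) := min_le_right _ _
    have h1 := rot_mem_cube ϱ (by positivity)
      (cube_mono Q (by positivity) (mul_le_mul_of_nonneg_right hε' hd.le) hX)
    refine hQG ?_
    convert! h1 using 1
    rw [← hκ]; field_simp
  · have := hGΩ hX
    simpa using this
  · exact cube_mono Q hclose.le (by linarith) (hnear X hX.1 (hGlow _ hX) hX.2.2)
  · exact cube_mono Q hclose.le (by linarith) hPQcube
  · rw [← hddef, ← hCd]
    exact cube_mono Q (by linarith) (by linarith)
      (mem_cube_add hPQcube hX.2 hclose.le (by positivity))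
  · rw [rot_rot_symm, hPE]
  · rw [rot_rot_symm, hPE]
    refine le_trans (ENNReal.ofReal_le_ofReal ?_) (hvol.trans (measure_mono ?_))
    · gcongr
      exact min_le_left _ _
    · refine inter_subset_inter_left _ ?_
      rintro _ ⟨X, ⟨hX1, hX2⟩, rfl⟩
      refine ⟨rot ϱ.symm X, ⟨hX1, ?_⟩, by simp⟩
      rw [preimage_rot_frontier]
      simpa using hX2
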